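/- **Setting.** A network has $M$ sensor nodes (set $\mathcal I_s$) and $K$ relay nodes (set $\mathcal I_r$), $\mathcal V=\mathcal I_s\cup\mathcal I_r$, with directed edge sets $\mathcal E(t)$, $t=0,1,2,\dots$, without self-loops and without relay-to-relay edges; $(j,i)\in\mathcal E(t)$ means that $j$ transmits to $i$. Let $\mathcal N_i(t)=\{j:(j,i)\in\mathcal E(t)\}$, $\mathcal N_i^s(t)=\mathcal N_i(t)\cap\mathcal I_s$, $\mathcal N_i^r(t)=\mathcal N_i(t)\cap\mathcal I_r$. With fading coefficients $h_{ij}(t)$, receiver noises $v_{ij}(t)$ and amplification factors $\alpha_j(t)$, node $i$ receives $u_i(t)=\sum_{j\in\mathcal N_i(t)}(\alpha_j(t)h_{ij}(t)x_j(t)+v_{ij}(t))$. Relays set $x_i(t)=u_i(t)$; sensors set $$x_i(t+1)=x_i(t)+a(t)\chi_i(t)\bigl(\theta+w_i(t)-x_i(t)\bigr)+a(t)\bigl(u_i(t)-b_i(t)x_i(t)\bigr),$$ where $\chi_i(t)\in\{0,1\}$ tells whether sensor $i$ has a measurement at time $t$. Let $\Gamma(t)=\mathrm{diag}(\gamma_i(t))_{i\in\mathcal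 I_s}$ with $$\gamma_i(t)=\sum_{j\in \mathcal{N}_i^s(t)} \alpha_j(t) h_{ij}(t)+\sum_{j\in \mathcal{N}_i^r(t)} \alpha_j(t) h_{ij}(t)\sum_{k\in \mathcal{N}_j^s(t)} \alpha_k(t) h_{jk}(t)-b_i(t).$$ The transmit power is $P_i(t)=\alpha_i(t)^2\,\mathbb E\{x_i(t)^2\}$ and the received power is $R_i(t)=\kappa\sum_{j\in\mathcal N_i(t)}P_j(t)$ with a constant $\kappa>0$. **Assumptions.** (1) There is an integer $B>0$ such that for every $k\ge0$ the directed graph with an edge $j\to i$ whenever the $(i,j)$ entry of $\sum_{t=kB}^{(k+1)B-1}\mathbb E\{[\mathbf 1_{(j,i)\in\mathcal E(t)}h_{ij}(t)]_{i,j}\}$ is positive is strongly connected. (2) For some $T>0$, within any $T$ consecutive steps some sensor has a measurement; the vectors $(w_i(t))_i$ are i.i.d. over $t$ with zero mean and finite variances. (3) The $h_{ij}(t)$ have means $\bar h_{ij}>0$ and finite variances and are independent across transmitters $j$ and times $t$; the $v_{ij}(t)$ have zero mean and finite variances, and the arrays $(v_{ij}(t))_{i,j}$ are independent over $t$. (4)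 The arrays $w(t),v(t),h(t)$, $t\ge0$, are mutually independent. **Parameters.** Let $d_s,d_r>0$ satisfy $d_s\ge|\mathcal N_i^s(t)|$ for all $i\in\mathcal V$ and $t$, and $d_r\ge|\mathcal N_i^r(t)|\,|\mathcal N_j^s(t)|^2$ for all $i\in\mathcal I_s$, $j\in\mathcal I_r$ and $t$. Put $\alpha_i(t)=d_s^{-1/2}$ for $i\in\mathcal I_s$, $\alpha_i(t)=d_r^{-1/2}$ for $i\in\mathcal I_r$, and $b_i(t)=\sum_{j\in\mathcal N_i(t)}b_{ij}(t)$ with $b_{ij}(t)=d_s^{-1/2}\bar h_{ij}$ for $j\in\mathcal N_i^s(t)$ and $b_{ij}(t)=(d_sd_r)^{-1/2}\bar h_{ij}\sum_{k\in\mathcal N_j^s(t)}\bar h_{jk}$ for $j\in\mathcal N_i^r(t)$. **Claim.** (i) Under Assumption (3), $\Gamma(t)$ is integrable and $\mathbb E\{\Gamma(t)\}=0$ for all $t$. (ii) Let Assumptions (1)–(4) hold, let $a(t)=t^{-\alpha}$ for $t\ge1$ with $0.5<\alpha\le1$, and $a(0)=a_0\ge0$. Let the initial sensor estimates $x_i(0)$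 be square integrable and independent of all disturbances (for instance constants), and let $\mathbb E\{h_{ij}(t)^2\}\le H$, $\mathbb E\{v_{ij}(t)^2\}\le V$, $\mathbb E\{w_i(t)^2\}\le W$, $\mathbb E\{x_i(0)^2\}\le X$ for all $i,j,t$. Let $q$ be such that at every time at which no relay receives from any sensor, each sensor receives from at most $q$ relays (if relays with nothing to forward stay silent, $q=0$; in a single network $q=K$ always works). Then every $x_i(t)$ is square integrable and there is a constant $C$, depending only on $\theta,\alpha,a_0,\kappa,d_s,d_r,H,V,W,X,q$ and not on the numbers $M$ and $K$ of sensor and relay nodes nor on anything else about the network, such that $P_i(t)\le C$ and $R_i(t)\le C$ for all nodes $i$ and all $t\ge0$. Moreover, for every $t$ and every $Q$ with $\mathbb E\{x_j(t)^2\}\le Q$ for all $j\in\mathcal I_s$, the following bounds hold: $P_i(t)\le Q/d_s$ for $i\in\mathcal I_s$; $P_i(t)\le HQ+V$ for $i\in\mathcal I_r$, if at time $t$ some sensor receives from a relay; $R_i(t)\le\kappa(Q+HQ+V)$ for all $i\in\mathcal V$. -/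

import Mathlib

open MeasureTheory ProbabilityTheory

universe u

noncomputable section

/-- The nodes of a network with `M` sensor nodes (`Sum.inl`) and `K` relay nodes (`Sum.inr`). -/
abbrev Node (M K : ℕ) : Type := Fin M ⊕ Fin K

/-- The data of a relay-assisted sensor network on a sample space `Ω`: the time-varying directed
graph, the sensors that have a measurement at each time, the fading coefficients, the receiver
noises, the measurement noises, and the initial estimates of the sensor nodes. -/
structure RelayNetwork (M K : ℕ) (Ω : Type u) [MeasurableSpace Ω] where
  /-- `(j, i) ∈ edges t` means that node `j` transmits to node `i` at time `t`. -/
  edges : ℕ → Finset (Node M K × Node M K)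
  /-- The set of sensors that have a measurement at time `t`. -/
  measuring : ℕ → Finset (Fin M)
  /-- `h t i j` is the fading coefficient of the link from `j` to `i`. -/
  h : ℕ → Node M K → Node M K → Ω → ℝ
  /-- `v t i j` is the receiver noise in the transmission from `j` to `i`. -/
  v : ℕ → Node M K → Node M K → Ω → ℝ
  /-- `w t i` is the measurement noise of sensor `i`. -/
  w : ℕ → Fin M → Ω → ℝ
  /-- The initial estimates. -/
  x₀ : Fin M → Ω → ℝ
  no_loop : ∀ t i, (i, i) ∉ edges t
  /-- Relays are one-hop: they receive data from sensors only. -/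
  no_relay_to_relay : ∀ t j k, (Sum.inr j, Sum.inr k) ∉ edges t
  measurable_h : ∀ t i j, Measurable (h t i j)
  measurable_v : ∀ t i j, Measurable (v t i j)
  measurable_w : ∀ t i, Measurable (w t i)
  measurable_x₀ : ∀ i, Measurable (x₀ i)

namespace RelayNetwork

section

variable {M K : ℕ} {Ω : Type u} [MeasurableSpace Ω] (G : RelayNetwork M K Ω)

/-! ### Neighbourhoods -/

/-- The neighbours of node `i` (the nodes it receives from) at time `t`. -/
def nbr (t : ℕ) (i : Node M K) : Finset (Node M K) :=
  Finset.univ.filter fun j => (j, i) ∈ G.edges t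

/-- The sensor neighbours of node `i`. -/
def sensorNbr (t : ℕ) (i : Node M K) : Finset (Fin M) :=
  Finset.univ.filter fun j => (Sum.inl j, i) ∈ G.edges t

/-- The relay neighbours of node `i`. -/
def relayNbr (t : ℕ) (i : Node M K) : Finset (Fin K) :=
  Finset.univ.filter fun j => (Sum.inr j, i) ∈ G.edges t

/-! ### The algorithm

`θ` is the unknown parameter, `a t` the decaying weight, `amp t i` the amplification factor of
node `i`, and `b t i` the weight of sensor `i`. -/

/-- The reception of relay `j` when the sensor estimates are `x`. -/
def relayReception (amp : ℕ → Node M K → ℝ) (t : ℕ) (x : Fin M → ℝ) (ω : Ω) (j : Fin K) : ℝ :=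
  ∑ k ∈ G.sensorNbr t (Sum.inr j),
    (amp t (Sum.inl k) * G.h t (Sum.inr j) (Sum.inl k) ω * x k
      + G.v t (Sum.inr j) (Sum.inl k) ω)

/-- The estimates of all nodes when the sensor estimates are `x`; the estimate of a relay is
its reception, which is forwarded instantaneously. -/
def nodeState (amp : ℕ → Node M K → ℝ) (t : ℕ) (x : Fin M → ℝ) (ω : Ω) : Node M K → ℝ :=
  Sum.elim x (G.relayReception amp t x ω)

/-- The data `u_i(t)` received at node `i` when the sensor estimates are `x`. -/
def received (amp : ℕ → Node M K → ℝ) (t : ℕ) (x : Fin M → ℝ) (ω : Ω) (i : Node M K) : ℝ :=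
  ∑ j ∈ G.nbr t i, (amp t j * G.h t i j ω * G.nodeState amp t x ω j + G.v t i j ω)

/-- For a relay, the estimate is the received data. -/
theorem received_inr (amp : ℕ → Node M K → ℝ) (t : ℕ) (x : Fin M → ℝ) (ω : Ω) (j : Fin K) :
    G.received amp t x ω (Sum.inr j) = G.nodeState amp t x ω (Sum.inr j) := by
  simp only [received, nodeState, nbr, relayReception, sensorNbr, Finset.sum_filter,
    Fintype.sum_sum_type, Sum.elim_inl, Sum.elim_inr]
  simp [G.no_relay_to_relay]

/-- The estimates of the sensor nodes. -/
def sensorEstimate (θ : ℝ) (a : ℕ → ℝ) (amp : ℕ → Node M K → ℝ) (b : ℕ → Fin M → ℝ) :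
    ℕ → Ω → Fin M → ℝ
  | 0, ω, i => G.x₀ i ω
  | t + 1, ω, i =>
      sensorEstimate θ a amp b t ω i
        + (if i ∈ G.measuring t then
            a t * ((θ + G.w t i ω) - sensorEstimate θ a amp b t ω i) else 0)
        + a t * (G.received amp t (sensorEstimate θ a amp b t ω) ω (Sum.inl i)
            - b t i * sensorEstimate θ a amp b t ω i)

/-- The estimate `x_i(t)` of an arbitrary node. -/
def estimate (θ : ℝ) (a : ℕ → ℝ) (amp : ℕ → Node M K → ℝ) (b : ℕ → Fin M → ℝ)
    (t : ℕ) (i : Node M K) (ω : Ω) : ℝ :=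
  G.nodeState amp t (G.sensorEstimate θ a amp b t ω) ω i

/-- The diagonal random uncertainty matrix `Γ(t)`. -/
def Gam (amp : ℕ → Node M K → ℝ) (b : ℕ → Fin M → ℝ) (t : ℕ) (ω : Ω) :
    Matrix (Fin M) (Fin M) ℝ :=
  Matrix.diagonal fun i =>
    ∑ j ∈ G.sensorNbr t (Sum.inl i), amp t (Sum.inl j) * G.h t (Sum.inl i) (Sum.inl j) ω
      + ∑ j ∈ G.relayNbr t (Sum.inl i), amp t (Sum.inr j) * G.h t (Sum.inl i) (Sum.inr j) ω *
          ∑ k ∈ G.sensorNbr t (Sum.inr j), amp t (Sum.inl k) * G.h t (Sum.inr j) (Sum.inl k) ω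
      - b t i

/-! ### Powers -/

/-- The transmit power `P_i(t) = α_i(t)² E[x_i(t)²]`. -/
def transmitPower (μ : Measure Ω) (θ : ℝ) (a : ℕ → ℝ) (amp : ℕ → Node M K → ℝ)
    (b : ℕ → Fin M → ℝ) (t : ℕ) (i : Node M K) : ℝ :=
  amp t i ^ 2 * ∫ ω, G.estimate θ a amp b t i ω ^ 2 ∂μ

/-- The received power `R_i(t)`, proportional with factor `κ` to the sum of the transmit powers
of the neighbours. -/
def receivedPower (μ : Measure Ω) (κ : ℝ) (θ : ℝ) (a : ℕ → ℝ) (amp : ℕ → Node M K → ℝ)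
    (b : ℕ → Fin M → ℝ) (t : ℕ) (i : Node M K) : ℝ :=
  κ * ∑ j ∈ G.nbr t i, G.transmitPower μ θ a amp b t j

/-! ### The design of the parameters -/

/-- The requirements on the constants `ds` and `dr` of the scaling rule. -/
structure ScalingConstants (ds dr : ℝ) : Prop where
  ds_pos : 0 < ds
  dr_pos : 0 < dr
  le_ds : ∀ t i, ((G.sensorNbr t i).card : ℝ) ≤ ds
  le_dr : ∀ t (i : Fin M) (j : Fin K),
    ((G.relayNbr t (Sum.inl i)).card : ℝ) * ((G.sensorNbr t (Sum.inr j)).card : ℝ) ^ 2 ≤ dr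

/-- The terms `b_{ij}(t)`, built from the channel means `hbar`. -/
def weightTerm (ds dr : ℝ) (hbar : Node M K → Node M K → ℝ) (t : ℕ) (i : Fin M) :
    Node M K → ℝ
  | Sum.inl j => ds ^ (-(1 / 2) : ℝ) * hbar (Sum.inl i) (Sum.inl j)
  | Sum.inr j => (ds * dr) ^ (-(1 / 2) : ℝ) * hbar (Sum.inl i) (Sum.inr j) *
      ∑ k ∈ G.sensorNbr t (Sum.inr j), hbar (Sum.inr j) (Sum.inl k)

/-- The weights `b_i(t)`. -/
def weight (ds dr : ℝ) (hbar : Node M K → Node M K → ℝ) (t : ℕ) (i : Fin M) : ℝ :=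
  ∑ j ∈ G.nbr t (Sum.inl i), G.weightTerm ds dr hbar t i j

/-! ### The standing assumptions -/

/-- The entry `(i, j)` of the sum of the expected weighted adjacency matrices over the window
`[kB, (k+1)B)`. -/
def averageAdj (μ : Measure Ω) (B k : ℕ) (i j : Node M K) : ℝ :=
  ∑ t ∈ Finset.Ico (k * B) ((k + 1) * B),
    ∫ ω, (if (j, i) ∈ G.edges t then 1 else 0) * G.h t i j ω ∂μ

/-- Joint strong connectivity on average. -/
def Assumption1 (μ : Measure Ω) : Prop :=
  ∃ B : ℕ, 0 < B ∧ ∀ k : ℕ, ∀ p q : Node M K,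
    Relation.ReflTransGen (fun j i => 0 < G.averageAdj μ B k i j) p q

/-- Within any `T` consecutive time steps some sensor has a measurement; the measurement noise
vectors are i.i.d. over time, with zero mean and finite variance (they may be correlated across
the sensors). -/
structure Assumption2 (μ : Measure Ω) : Prop where
  measurements : ∃ T : ℕ, 0 < T ∧ ∀ t, ∃ s, t ≤ s ∧ s < t + T ∧ (G.measuring s).Nonempty
  indep : iIndepFun (fun (t : ℕ) (ω : Ω) (i : Fin M) => G.w t i ω) μ
  identDistrib : ∀ t, IdentDistrib (fun (ω : Ω) (i : Fin M) => G.w t i ω)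
    (fun (ω : Ω) (i : Fin M) => G.w 0 i ω) μ μ
  memLp : ∀ t i, MemLp (G.w t i) 2 μ
  mean : ∀ t i, ∫ ω, G.w t i ω ∂μ = 0

/-- The fading coefficients have positive means `hbar i j` and finite variances, and are
independent across transmitters and time steps; the receiver noises have zero mean and finite
variance, and are independent over time. -/
structure Assumption3 (μ : Measure Ω) (hbar : Node M K → Node M K → ℝ) : Prop where
  memLp_h : ∀ t i j, MemLp (G.h t i j) 2 μ
  mean_h : ∀ t i j, ∫ ω, G.h t i j ω ∂μ = hbar i j
  hbar_pos : ∀ i j, 0 < hbar i j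
  indep_h : iIndepFun (fun (p : ℕ × Node M K) (ω : Ω) (i : Node M K) => G.h p.1 i p.2 ω) μ
  memLp_v : ∀ t i j, MemLp (G.v t i j) 2 μ
  mean_v : ∀ t i j, ∫ ω, G.v t i j ω ∂μ = 0
  indep_v : iIndepFun (fun (t : ℕ) (ω : Ω) (i j : Node M K) => G.v t i j ω) μ

/-- All disturbances at time `t`: measurement noises, receiver noises, fading coefficients. -/
def disturbance (t : ℕ) (ω : Ω) :
    (Fin M → ℝ) × (Node M K → Node M K → ℝ) × (Node M K → Node M K → ℝ) :=
  (fun i => G.w t i ω, fun i j => G.v t i j ω, fun i j => G.h t i j ω)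

/-- The random arrays `w(t)`, `v(t)`, `h(t)`, `t ≥ 0`, are mutually independent: the triples
`(w(t), v(t), h(t))` are mutually independent over `t`, and for each `t` the three entries are
mutually independent. -/
structure Assumption4 (μ : Measure Ω) : Prop where
  over_time : iIndepFun (fun t => G.disturbance t) μ
  w_vh : ∀ t, IndepFun (fun ω => (G.disturbance t ω).1) (fun ω => (G.disturbance t ω).2) μ
  v_h : ∀ t, IndepFun (fun ω => (G.disturbance t ω).2.1) (fun ω => (G.disturbance t ω).2.2) μ

/-- The initial estimates (for instance, constants) are square integrable and independent of
all disturbances. -/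
structure AdmissibleInit (μ : Measure Ω) : Prop where
  memLp : ∀ i, MemLp (G.x₀ i) 2 μ
  indep : IndepFun (fun (ω : Ω) (i : Fin M) => G.x₀ i ω) (fun (ω : Ω) (t : ℕ) => G.disturbance t ω) μ

/-- Common bounds `H`, `V`, `W`, `X` on the second moments of the fading coefficients, receiver
noises, measurement noises and initial estimates. -/
structure MomentBounds (μ : Measure Ω) (H V W X : ℝ) : Prop where
  h_le : ∀ t i j, ∫ ω, G.h t i j ω ^ 2 ∂μ ≤ H
  v_le : ∀ t i j, ∫ ω, G.v t i j ω ^ 2 ∂μ ≤ V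
  w_le : ∀ t i, ∫ ω, G.w t i ω ^ 2 ∂μ ≤ W
  x₀_le : ∀ i, ∫ ω, G.x₀ i ω ^ 2 ∂μ ≤ X

/-- At any time at which no relay receives from a sensor, so that relays have nothing to forward,
each sensor still listens to at most `q` relays. (At all other times the number of relays that a
sensor listens to is at most `dr`.) In a single network this holds with `q = K`. -/
def IdleRelayBound (q : ℕ) : Prop :=
  ∀ t, (∀ j : Fin K, G.sensorNbr t (Sum.inr j) = ∅) →
    ∀ i : Fin M, (G.relayNbr t (Sum.inl i)).card ≤ q

end

end RelayNetwork

/-- The scaling rule: `ds ^ (-1/2)` for sensors and `dr ^ (-1/2)` for relays. -/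
def scalingRule (M K : ℕ) (ds dr : ℝ) (_t : ℕ) : Node M K → ℝ
  | Sum.inl _ => ds ^ (-(1 / 2) : ℝ)
  | Sum.inr _ => dr ^ (-(1 / 2) : ℝ)

/-- The decaying weight `a(t) = t ^ (-α)` for `t ≥ 1`, with an arbitrary value `a₀` at `t = 0`,
where `t ^ (-α)` is undefined. -/
def powerWeight (a₀ α : ℝ) (t : ℕ) : ℝ :=
  if t = 0 then a₀ else (t : ℝ) ^ (-α)

end

-- The proof controls the largest second moment of the sensor estimates. The estimates at time `t`
-- are a function of the initial estimates and the past disturbances, hence independent of the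
-- current disturbance, so they may be frozen at a vector `x` and averaged afterwards. Given `x`,
-- sensor `i` moves to `(1 - S) x_i + r θ + a (noise + u_i)`, where `r` is `a(t)` or `0` and `S = r
-- + a b_i`. The mean of `u_i` is `∑ c_k x_k` with nonnegative mean gains `c_k` whose sum is exactly
-- `b_i` (`sum_meanGain`); the same tuning makes `Γ(t)` centred. The conditional mean is therefore a
-- combination of `x_i`, `θ` and the `x_k` with coefficients of sum 1, so there is no growth of
-- first order in `a(t)`.
--
-- Jensen's inequality (`sq_affine_combination_le`) costs a factor `(|1 - S| + S)^2 ≤ 1 + 4 S^2`,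
-- and the fluctuations enter with `a(t)^2`. A common bound `Z` thus passes to `(1 + C a(t)^2) Z`
-- (`nextMoment_le`), and the product of these factors converges because `α > 1/2` makes `a(t)^2`
-- summable.
--
-- The constant does not see the size of the network because `ds`, `dr` and `q` bound the number of
-- neighbours and the weights, and because the scaling rule keeps the total power of the neighbours
-- of any node below `Q + (H Q + V)` (`sum_nbr_power_le`). That estimate also yields the explicit
-- power bounds.

noncomputable section

/-! ### Independence and second moments -/

/-- Up to reassociation both factorisations give the joint law as the triple product of the
marginals. It serves to join initial estimates with past disturbances, and receiver noises with
fading columns. -/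
theorem indepFun_prodMk_of_indepFun_prodMk {Ω E F F' : Type*} [MeasurableSpace Ω]
    [MeasurableSpace E] [MeasurableSpace F] [MeasurableSpace F'] {μ : Measure Ω}
    [IsProbabilityMeasure μ] {X : Ω → E} {Y : Ω → F} {Z : Ω → F'} (hX : Measurable X)
    (hY : Measurable Y) (hZ : Measurable Z) (h : IndepFun X (fun ω => (Y ω, Z ω)) μ)
    (hYZ : IndepFun Y Z μ) : IndepFun (fun ω => (X ω, Y ω)) Z μ := by
  have hXY : IndepFun X Y μ := h.comp measurable_id measurable_fst
  have := Measure.isProbabilityMeasure_map (μ := μ) hX.aemeasurable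
  have := Measure.isProbabilityMeasure_map (μ := μ) hY.aemeasurable
  have := Measure.isProbabilityMeasure_map (μ := μ) hZ.aemeasurable
  rw [indepFun_iff_map_prod_eq_prod_map_map (by fun_prop) (by fun_prop)] at h hXY hYZ ⊢
  rw [hXY, ← MeasurableEquiv.prodAssoc.map_measurableEquiv_injective.eq_iff,
    Measure.prodAssoc_prod, ← hYZ, ← h,
    Measure.map_map MeasurableEquiv.prodAssoc.measurable (by fun_prop)]
  rfl

/-- If the second moments of `Φ (x, D)` are bounded by `g x` and `X` is independent of `D`, then
`Φ (X, D)` has a second moment bounded by the expectation of `g X`. -/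
theorem memLp_two_and_integral_sq_le_of_indepFun {Ω E F : Type*} [MeasurableSpace Ω]
    [MeasurableSpace E] [MeasurableSpace F] {μ : Measure Ω} [IsProbabilityMeasure μ]
    {X : Ω → E} {D : Ω → F} (hX : Measurable X) (hD : Measurable D) (h : IndepFun X D μ)
    {Φ : E × F → ℝ} (hΦ : Measurable Φ) {g : E → ℝ} (hg : Measurable g)
    (hgX : Integrable (fun ω => g (X ω)) μ) (hL : ∀ x, MemLp (fun ω => Φ (x, D ω)) 2 μ)
    (hle : ∀ x, ∫ ω, Φ (x, D ω) ^ 2 ∂μ ≤ g x) :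
    MemLp (fun ω => Φ (X ω, D ω)) 2 μ ∧ ∫ ω, Φ (X ω, D ω) ^ 2 ∂μ ≤ ∫ ω, g (X ω) ∂μ := by
  have := Measure.isProbabilityMeasure_map (μ := μ) hX.aemeasurable
  have := Measure.isProbabilityMeasure_map (μ := μ) hD.aemeasurable
  have hprod := h.map_prod_eq_prod_map_map hX.aemeasurable hD.aemeasurable
  have hmap : ∀ x, ∫ d, Φ (x, d) ^ 2 ∂(μ.map D) = ∫ ω, Φ (x, D ω) ^ 2 ∂μ := fun x =>
    integral_map hD.aemeasurable
      ((hΦ.comp measurable_prodMk_left).pow_const 2).aestronglyMeasurable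
  have hgint : Integrable g (μ.map X) :=
    (integrable_map_measure hg.aestronglyMeasurable hX.aemeasurable).2 hgX
  have hsq : Measurable fun p : E × F => Φ p ^ 2 := hΦ.pow_const 2
  have hmeas : AEStronglyMeasurable (fun x => ∫ d, Φ (x, d) ^ 2 ∂(μ.map D)) (μ.map X) :=
    (hsq.stronglyMeasurable.integral_prod_right' (ν := μ.map D)).aestronglyMeasurable
  have hint : Integrable (fun p : E × F => Φ p ^ 2) ((μ.map X).prod (μ.map D)) := by
    refine (integrable_prod_iff hsq.aestronglyMeasurable).2 ⟨Filter.Eventually.of_forall ?_, ?_⟩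
    · intro x
      exact (integrable_map_measure (f := D) (g := fun d => Φ (x, d) ^ 2)
        ((hΦ.comp measurable_prodMk_left).pow_const 2).aestronglyMeasurable
        hD.aemeasurable).2 (hL x).integrable_sq
    · simp only [norm_pow, Real.norm_eq_abs, sq_abs]
      refine hgint.mono' hmeas (Filter.Eventually.of_forall fun x => ?_)
      rw [Real.norm_of_nonneg (integral_nonneg fun d => sq_nonneg _), hmap]
      exact hle x
  have hint' : Integrable (fun ω => Φ (X ω, D ω) ^ 2) μ := by
    rw [← hprod] at hint
    exact (integrable_map_measure hsq.aestronglyMeasurable (hX.prodMk hD).aemeasurable).1 hint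
  refine ⟨(memLp_two_iff_integrable_sq
    (hΦ.comp (hX.prodMk hD)).aestronglyMeasurable).2 hint', ?_⟩
  calc ∫ ω, Φ (X ω, D ω) ^ 2 ∂μ
      = ∫ p, Φ p ^ 2 ∂(μ.map fun ω => (X ω, D ω)) :=
        (integral_map (hX.prodMk hD).aemeasurable hsq.aestronglyMeasurable).symm
    _ = ∫ x, ∫ d, Φ (x, d) ^ 2 ∂(μ.map D) ∂(μ.map X) := by
        rw [hprod, integral_prod _ hint]
    _ ≤ ∫ x, g x ∂(μ.map X) := by
        refine integral_mono_of_nonneg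
          (Filter.Eventually.of_forall fun x => integral_nonneg fun d => sq_nonneg _) hgint
          (Filter.Eventually.of_forall fun x => ?_)
        simpa only [hmap] using hle x
    _ = ∫ ω, g (X ω) ∂μ := integral_map hX.aemeasurable hg.aestronglyMeasurable

section SecondMoments

variable {Ω : Type*} [MeasurableSpace Ω] {μ : Measure Ω}

theorem integral_sum_sq_le {ι : Type*} (s : Finset ι) {f : ι → Ω → ℝ}
    (hf : ∀ i ∈ s, MemLp (f i) 2 μ) :
    ∫ ω, (∑ i ∈ s, f i ω) ^ 2 ∂μ ≤ s.card * ∑ i ∈ s, ∫ ω, f i ω ^ 2 ∂μ := by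
  rw [← integral_finsetSum s fun i hi => (hf i hi).integrable_sq, ← integral_const_mul]
  refine integral_mono (memLp_finsetSum s hf).integrable_sq
    ((integrable_finsetSum s fun i hi => (hf i hi).integrable_sq).const_mul _) fun ω => ?_
  exact sq_sum_le_card_mul_sum_sq

theorem integral_add_sq_le {f g : Ω → ℝ} (hf : MemLp f 2 μ) (hg : MemLp g 2 μ) :
    ∫ ω, (f ω + g ω) ^ 2 ∂μ ≤ 2 * ∫ ω, f ω ^ 2 ∂μ + 2 * ∫ ω, g ω ^ 2 ∂μ := by
  rw [← integral_const_mul, ← integral_const_mul,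
    ← integral_add (hf.integrable_sq.const_mul _) (hg.integrable_sq.const_mul _)]
  refine integral_mono (hf.add hg).integrable_sq
    ((hf.integrable_sq.const_mul _).add (hg.integrable_sq.const_mul _)) fun ω => ?_
  have := sq_nonneg (f ω - g ω)
  simp only
  nlinarith

theorem integral_add_sq_of_indepFun [IsProbabilityMeasure μ] {f g : Ω → ℝ} (hf : MemLp f 2 μ)
    (hg : MemLp g 2 μ) (h : IndepFun f g μ) (hg0 : ∫ ω, g ω ∂μ = 0) :
    ∫ ω, (f ω + g ω) ^ 2 ∂μ = ∫ ω, f ω ^ 2 ∂μ + ∫ ω, g ω ^ 2 ∂μ := by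
  have hfg : Integrable (fun ω => f ω * g ω) μ := hf.integrable_mul hg
  have h0 : ∫ ω, f ω * g ω ∂μ = 0 := by
    rw [h.integral_fun_mul_eq_mul_integral hf.aestronglyMeasurable hg.aestronglyMeasurable, hg0,
      mul_zero]
  have : ∀ ω, (f ω + g ω) ^ 2 = f ω ^ 2 + g ω ^ 2 + 2 * (f ω * g ω) := fun ω => by ring
  simp only [this]
  have hadd : Integrable (fun ω => f ω ^ 2 + g ω ^ 2) μ := hf.integrable_sq.add hg.integrable_sq
  rw [integral_add hadd (hfg.const_mul _),
    integral_add hf.integrable_sq hg.integrable_sq, integral_const_mul, h0]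
  ring

/-- Relayed signals are products of fading coefficients with only two moments; independence of the
squares replaces the fourth moments that Hölder would require. -/
theorem memLp_two_mul_of_indepFun {f g : Ω → ℝ} (hf : MemLp f 2 μ)
    (hg : MemLp g 2 μ) (h : IndepFun f g μ) :
    MemLp (fun ω => f ω * g ω) 2 μ ∧
      ∫ ω, (f ω * g ω) ^ 2 ∂μ = (∫ ω, f ω ^ 2 ∂μ) * ∫ ω, g ω ^ 2 ∂μ := by
  have h2 : IndepFun (fun ω => f ω ^ 2) (fun ω => g ω ^ 2) μ :=
    h.comp (measurable_id.pow_const 2) (measurable_id.pow_const 2)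
  have hint : Integrable (fun ω => f ω ^ 2 * g ω ^ 2) μ :=
    h2.integrable_mul hf.integrable_sq hg.integrable_sq
  simp only [mul_pow]
  refine ⟨(memLp_two_iff_integrable_sq
    (hf.aestronglyMeasurable.mul hg.aestronglyMeasurable)).2 ?_, ?_⟩
  · simpa only [Pi.mul_apply, mul_pow] using hint
  · exact h2.integral_fun_mul_eq_mul_integral hf.integrable_sq.aestronglyMeasurable
      hg.integrable_sq.aestronglyMeasurable

theorem sq_integral_le_integral_sq [IsProbabilityMeasure μ] {f : Ω → ℝ} (hf : MemLp f 2 μ) :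
    (∫ ω, f ω ∂μ) ^ 2 ≤ ∫ ω, f ω ^ 2 ∂μ := by
  have h1 := variance_eq_sub hf
  have h2 := variance_nonneg f μ
  simp only [Pi.pow_apply] at h1
  linarith

/-- The second moment of `c + a Y` is at most the square of its mean plus `a ^ 2` times the second
moment of `Y`. -/
theorem integral_const_add_mul_sq_le [IsProbabilityMeasure μ] {Y : Ω → ℝ} (hY : MemLp Y 2 μ)
    (c a : ℝ) :
    ∫ ω, (c + a * Y ω) ^ 2 ∂μ ≤ (c + a * ∫ ω, Y ω ∂μ) ^ 2 + a ^ 2 * ∫ ω, Y ω ^ 2 ∂μ := by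
  have hYi : Integrable Y μ := hY.integrable one_le_two
  have : ∀ ω, (c + a * Y ω) ^ 2 = (c ^ 2 + 2 * c * a * Y ω) + a ^ 2 * Y ω ^ 2 :=
    fun ω => by ring
  simp only [this]
  have hadd : Integrable (fun ω => c ^ 2 + 2 * c * a * Y ω) μ :=
    (integrable_const _).add (hYi.const_mul _)
  rw [integral_add hadd (hY.integrable_sq.const_mul _),
    integral_add (integrable_const _) (hYi.const_mul _), integral_const_mul, integral_const_mul]
  simp only [integral_const, probReal_univ, smul_eq_mul, one_mul]
  -- The slack is the squared mean of `a Y`: a variance is bounded by a second moment.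
  nlinarith [sq_nonneg (a * ∫ ω, Y ω ∂μ)]

end SecondMoments

end

noncomputable section

namespace RelayNetwork

section

variable {M K : ℕ} {Ω : Type u} [MeasurableSpace Ω] (G : RelayNetwork M K Ω)

/-! ### Neighbourhoods and the scaling constants -/

theorem sum_nbr (t : ℕ) (i : Node M K) (f : Node M K → ℝ) :
    ∑ j ∈ G.nbr t i, f j
      = ∑ j ∈ G.sensorNbr t i, f (Sum.inl j) + ∑ j ∈ G.relayNbr t i, f (Sum.inr j) := by
  simp only [nbr, sensorNbr, relayNbr, Finset.sum_filter, Fintype.sum_sum_type]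

theorem card_nbr (t : ℕ) (i : Node M K) :
    ((G.nbr t i).card : ℝ) = (G.sensorNbr t i).card + (G.relayNbr t i).card := by
  have := G.sum_nbr t i fun _ => 1
  simpa using this

theorem relayNbr_inr (t : ℕ) (j : Fin K) : G.relayNbr t (Sum.inr j) = ∅ := by
  ext k
  simp [relayNbr, G.no_relay_to_relay]

variable {G}

/-- One relay anywhere that hears a sensor suffices: its sensor count is at least 1, so the
requirement on `dr` bounds the relay count of every sensor. Otherwise the idle bound `q` applies. -/
theorem ScalingConstants.card_relayNbr_le {ds dr : ℝ} (hG : G.ScalingConstants ds dr) {q : ℕ}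
    (hq : G.IdleRelayBound q) (t : ℕ) (i : Node M K) :
    ((G.relayNbr t i).card : ℝ) ≤ dr + q := by
  have hdr := hG.dr_pos
  rcases i with i | i
  · by_cases h : ∀ j : Fin K, G.sensorNbr t (Sum.inr j) = ∅
    · have : ((G.relayNbr t (Sum.inl i)).card : ℝ) ≤ q := by exact_mod_cast hq t h i
      linarith
    · push Not at h
      obtain ⟨j, hj⟩ := h
      have h1 : (1 : ℝ) ≤ (G.sensorNbr t (Sum.inr j)).card := by
        exact_mod_cast Finset.card_pos.2 hj
      have h2 := hG.le_dr t i j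
      have h3 : ((G.relayNbr t (Sum.inl i)).card : ℝ) * 1 ≤ dr :=
        (mul_le_mul_of_nonneg_left (one_le_pow₀ h1) (Nat.cast_nonneg _)).trans h2
      have : (0 : ℝ) ≤ q := Nat.cast_nonneg _
      linarith
  · rw [relayNbr_inr]
    simp only [Finset.card_empty, Nat.cast_zero]
    positivity

theorem ScalingConstants.card_nbr_le {ds dr : ℝ} (hG : G.ScalingConstants ds dr) {q : ℕ}
    (hq : G.IdleRelayBound q) (t : ℕ) (i : Node M K) :
    ((G.nbr t i).card : ℝ) ≤ ds + dr + q := by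
  rw [card_nbr]
  linarith [hG.le_ds t i, hG.card_relayNbr_le hq t i]

variable (G)

/-! ### Measurability and dependence on the disturbances -/

section Measurability

variable {β : Type*} [MeasurableSpace β] (amp : ℕ → Node M K → ℝ) (t : ℕ)

theorem measurable_relayReception {X : β → Fin M → ℝ} {D : β → Ω} (hX : Measurable X)
    (hD : Measurable D) (j : Fin K) :
    Measurable fun z => G.relayReception amp t (X z) (D z) j := by
  unfold relayReception
  refine Finset.measurable_sum _ fun k _ => ?_
  have h1 := (G.measurable_h t (Sum.inr j) (Sum.inl k)).comp hD
  have h2 := (G.measurable_v t (Sum.inr j) (Sum.inl k)).comp hD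
  have h3 := (measurable_pi_apply k).comp hX
  exact ((h1.const_mul _).mul h3).add h2

theorem measurable_nodeState {X : β → Fin M → ℝ} {D : β → Ω} (hX : Measurable X)
    (hD : Measurable D) (i : Node M K) :
    Measurable fun z => G.nodeState amp t (X z) (D z) i := by
  rcases i with i | i
  · exact (measurable_pi_apply i).comp hX
  · exact G.measurable_relayReception amp t hX hD i

theorem measurable_received {X : β → Fin M → ℝ} {D : β → Ω} (hX : Measurable X)
    (hD : Measurable D) (i : Node M K) :
    Measurable fun z => G.received amp t (X z) (D z) i := by
  unfold received
  refine Finset.measurable_sum _ fun k _ => ?_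
  have h1 := (G.measurable_h t i k).comp hD
  have h2 := (G.measurable_v t i k).comp hD
  exact ((h1.const_mul _).mul (G.measurable_nodeState amp t hX hD k)).add h2

end Measurability

/-- The estimate of sensor `i` at time `t + 1` when the sensor estimates at time `t` are `x`. -/
def nextEstimate (θ : ℝ) (a : ℕ → ℝ) (amp : ℕ → Node M K → ℝ) (b : ℕ → Fin M → ℝ) (t : ℕ)
    (i : Fin M) (x : Fin M → ℝ) (ω : Ω) : ℝ :=
  x i + (if i ∈ G.measuring t then a t * ((θ + G.w t i ω) - x i) else 0)
    + a t * (G.received amp t x ω (Sum.inl i) - b t i * x i)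

theorem measurable_nextEstimate {β : Type*} [MeasurableSpace β] (θ : ℝ) (a : ℕ → ℝ)
    (amp : ℕ → Node M K → ℝ) (b : ℕ → Fin M → ℝ) (t : ℕ) {X : β → Fin M → ℝ} {D : β → Ω}
    (hX : Measurable X) (hD : Measurable D) (i : Fin M) :
    Measurable fun z => G.nextEstimate θ a amp b t i (X z) (D z) := by
  unfold nextEstimate
  have hw := (G.measurable_w t i).comp hD
  have hx := (measurable_pi_apply i).comp hX
  have hu := G.measurable_received amp t hX hD (Sum.inl i)
  have h : Measurable fun z => if i ∈ G.measuring t then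
      a t * ((θ + G.w t i (D z)) - X z i) else 0 := by
    split_ifs
    · exact ((hw.const_add θ).sub hx).const_mul _
    · exact measurable_const
  exact (hx.add h).add ((hu.sub (hx.const_mul _)).const_mul _)

theorem measurable_sensorEstimate (θ : ℝ) (a : ℕ → ℝ) (amp : ℕ → Node M K → ℝ)
    (b : ℕ → Fin M → ℝ) (t : ℕ) : Measurable (G.sensorEstimate θ a amp b t) := by
  induction t with
  | zero => exact measurable_pi_lambda _ fun i => G.measurable_x₀ i
  | succ t ih =>
    exact measurable_pi_lambda _ fun i =>
      G.measurable_nextEstimate θ a amp b t ih measurable_id i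

theorem measurable_disturbance (t : ℕ) : Measurable (G.disturbance t) := by
  refine Measurable.prodMk (measurable_pi_lambda _ fun i => G.measurable_w t i)
    (Measurable.prodMk ?_ ?_)
  · exact measurable_pi_lambda _ fun i => measurable_pi_lambda _ fun j => G.measurable_v t i j
  · exact measurable_pi_lambda _ fun i => measurable_pi_lambda _ fun j => G.measurable_h t i j

/-- The network with the same graph whose disturbances at each time are the coordinates on the
space of disturbances. -/
def coordinateNetwork :
    RelayNetwork M K ((Fin M → ℝ) × (Node M K → Node M K → ℝ) × (Node M K → Node M K → ℝ)) where
  edges := G.edges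
  measuring := G.measuring
  h _ i j d := d.2.2 i j
  v _ i j d := d.2.1 i j
  w _ i d := d.1 i
  -- A dummy value: a single step of the recursion never reads the initial estimates.
  x₀ _ _ := 0
  no_loop := G.no_loop
  no_relay_to_relay := G.no_relay_to_relay
  measurable_h _ i j := by fun_prop
  measurable_v _ i j := by fun_prop
  measurable_w _ i := by fun_prop
  measurable_x₀ _ := measurable_const

/-- One step sees `ω` only through the disturbance at time `t`. This turns it into a measurable
function on a product space, as the freezing argument needs. -/
theorem nextEstimate_eq_coordinate (θ : ℝ) (a : ℕ → ℝ) (amp : ℕ → Node M K → ℝ)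
    (b : ℕ → Fin M → ℝ) (t : ℕ) (i : Fin M) (x : Fin M → ℝ) (ω : Ω) :
    G.nextEstimate θ a amp b t i x ω
      = G.coordinateNetwork.nextEstimate θ a amp b t i x (G.disturbance t ω) := by
  have h : ∀ k, G.nodeState amp t x ω k
      = G.coordinateNetwork.nodeState amp t x (G.disturbance t ω) k := by
    rintro (k | k) <;> rfl
  simp only [nextEstimate, received, h]
  rfl

/-- The sensor estimates at time `t` are a function of the initial estimates and of the
disturbances before time `t`. -/
theorem exists_sensorEstimate_eq (θ : ℝ) (a : ℕ → ℝ) (amp : ℕ → Node M K → ℝ)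
    (b : ℕ → Fin M → ℝ) (t n : ℕ) (htn : t ≤ n) :
    ∃ F : (Fin M → ℝ) × (Finset.range n → (Fin M → ℝ) × (Node M K → Node M K → ℝ) ×
        (Node M K → Node M K → ℝ)) → Fin M → ℝ, Measurable F ∧
      ∀ ω, G.sensorEstimate θ a amp b t ω
        = F (fun i => G.x₀ i ω, fun s => G.disturbance s ω) := by
  -- The horizon `n` stays fixed, so the domain of `F` does not change along the induction.
  induction t with
  | zero => exact ⟨Prod.fst, measurable_fst, fun ω => rfl⟩
  | succ t ih =>
    obtain ⟨F, hF, hF'⟩ := ih (Nat.le_of_succ_le htn)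
    let s : Finset.range n := ⟨t, Finset.mem_range.2 htn⟩
    refine ⟨fun z i => G.coordinateNetwork.nextEstimate θ a amp b t i (F z) (z.2 s), ?_, ?_⟩
    · exact measurable_pi_lambda _ fun i => G.coordinateNetwork.measurable_nextEstimate θ a amp b t
        hF ((measurable_pi_apply s).comp measurable_snd) i
    · intro ω
      ext i
      simp only [← hF' ω]
      exact G.nextEstimate_eq_coordinate θ a amp b t i _ ω

/-- Past and present disturbances are independent, and the initial estimates are independent of both
together; regrouping makes the pair (initial estimates, past) independent of the present. -/
theorem indepFun_sensorEstimate_disturbance {μ : Measure Ω} [IsProbabilityMeasure μ]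
    (h4 : G.Assumption4 μ) (h0 : G.AdmissibleInit μ) (θ : ℝ) (a : ℕ → ℝ)
    (amp : ℕ → Node M K → ℝ) (b : ℕ → Fin M → ℝ) (t : ℕ) :
    IndepFun (G.sensorEstimate θ a amp b t) (G.disturbance t) μ := by
  obtain ⟨F, hF, hF'⟩ := G.exists_sensorEstimate_eq θ a amp b t t le_rfl
  have hx : Measurable fun ω i => G.x₀ i ω := measurable_pi_lambda _ G.measurable_x₀
  have hpast : Measurable fun ω (s : Finset.range t) => G.disturbance s ω :=
    measurable_pi_lambda _ fun s => G.measurable_disturbance s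
  have h1 : IndepFun (fun ω (s : Finset.range t) => G.disturbance s ω) (G.disturbance t) μ :=
    (h4.over_time.indepFun_finset (Finset.range t) {t} (by simp) G.measurable_disturbance).comp
      measurable_id (measurable_pi_apply (⟨t, by simp⟩ : ({t} : Finset ℕ)))
  have h2 : IndepFun (fun ω i => G.x₀ i ω)
      (fun ω => ((fun s : Finset.range t => G.disturbance s ω), G.disturbance t ω)) μ :=
    h0.indep.comp (ψ := fun d : ℕ → (Fin M → ℝ) × (Node M K → Node M K → ℝ) ×
        (Node M K → Node M K → ℝ) => ((fun s : Finset.range t => d s), d t))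
      measurable_id (by fun_prop)
  have h3 := indepFun_prodMk_of_indepFun_prodMk hx hpast (G.measurable_disturbance t) h2 h1
  have h5 : G.sensorEstimate θ a amp b t
      = F ∘ fun ω => ((fun i => G.x₀ i ω), fun s : Finset.range t => G.disturbance s ω) :=
    funext hF'
  rw [h5]
  exact h3.comp hF measurable_id

end

end RelayNetwork

end

noncomputable section

theorem scalingRule_inl {M K : ℕ} (ds dr : ℝ) (t : ℕ) (k : Fin M) :
    scalingRule M K ds dr t (Sum.inl k) = ds ^ (-(1 / 2) : ℝ) := rfl

theorem scalingRule_inr {M K : ℕ} (ds dr : ℝ) (t : ℕ) (j : Fin K) :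
    scalingRule M K ds dr t (Sum.inr j) = dr ^ (-(1 / 2) : ℝ) := rfl

theorem rpow_neg_half_sq {d : ℝ} (hd : 0 < d) : (d ^ (-(1 / 2) : ℝ)) ^ 2 = d⁻¹ := by
  rw [← Real.rpow_natCast, ← Real.rpow_mul hd.le]
  norm_num
  exact Real.rpow_neg_one d

namespace RelayNetwork

section

variable {M K : ℕ} {Ω : Type u} [MeasurableSpace Ω] (G : RelayNetwork M K Ω) {μ : Measure Ω}
  {hbar : Node M K → Node M K → ℝ}

/-! ### The mean gain from each sensor -/

/-- The expected total gain with which the estimate of sensor `k` is received at sensor `i`,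
directly and through the relays. -/
def meanGain (ds dr : ℝ) (hbar : Node M K → Node M K → ℝ) (t : ℕ) (i k : Fin M) : ℝ :=
  (if k ∈ G.sensorNbr t (Sum.inl i) then
      ds ^ (-(1 / 2) : ℝ) * hbar (Sum.inl i) (Sum.inl k) else 0)
    + ∑ j ∈ G.relayNbr t (Sum.inl i), if k ∈ G.sensorNbr t (Sum.inr j) then
        (ds * dr) ^ (-(1 / 2) : ℝ) * hbar (Sum.inl i) (Sum.inr j) * hbar (Sum.inr j) (Sum.inl k)
      else 0

theorem sum_meanGain_mul (ds dr : ℝ) (hbar : Node M K → Node M K → ℝ) (t : ℕ) (i : Fin M)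
    (x : Fin M → ℝ) :
    ∑ k, G.meanGain ds dr hbar t i k * x k
      = ∑ k ∈ G.sensorNbr t (Sum.inl i), ds ^ (-(1 / 2) : ℝ) * hbar (Sum.inl i) (Sum.inl k) * x k
        + ∑ j ∈ G.relayNbr t (Sum.inl i), ∑ k ∈ G.sensorNbr t (Sum.inr j),
          (ds * dr) ^ (-(1 / 2) : ℝ) * hbar (Sum.inl i) (Sum.inr j)
            * hbar (Sum.inr j) (Sum.inl k) * x k := by
  simp only [meanGain, add_mul, Finset.sum_add_distrib, ite_mul, zero_mul, Finset.sum_mul]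
  rw [Finset.sum_comm (s := Finset.univ)]
  simp

/-- The point of the choice of `b_i(t)`: the gains received on average are exactly compensated,
which removes the first-order growth. -/
theorem sum_meanGain (ds dr : ℝ) (hbar : Node M K → Node M K → ℝ) (t : ℕ) (i : Fin M) :
    ∑ k, G.meanGain ds dr hbar t i k = G.weight ds dr hbar t i := by
  have := G.sum_meanGain_mul ds dr hbar t i fun _ => 1
  simp only [mul_one] at this
  rw [this, weight, sum_nbr]
  simp only [weightTerm, Finset.mul_sum]

theorem meanGain_nonneg {ds dr : ℝ} (hs : 0 < ds) (hr : 0 < dr) (hh : ∀ i j, 0 < hbar i j) (t : ℕ)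
    (i k : Fin M) : 0 ≤ G.meanGain ds dr hbar t i k := by
  unfold meanGain
  refine add_nonneg ?_ (Finset.sum_nonneg fun j _ => ?_) <;> split_ifs
  · exact mul_nonneg (Real.rpow_nonneg hs.le _) (hh _ _).le
  · exact le_rfl
  · exact mul_nonneg (mul_nonneg (Real.rpow_nonneg (mul_pos hs hr).le _) (hh _ _).le) (hh _ _).le
  · exact le_rfl

variable {G}

/-- There are at most `ds` direct links and at most `dr + q` relays, each hearing at most `ds`
sensors; hence a bound free of `M` and `K`. -/
theorem weight_le {ds dr H : ℝ} {q : ℕ} (hG : G.ScalingConstants ds dr) (hq : G.IdleRelayBound q)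
    (hh : ∀ i j, 0 < hbar i j) (hH : 0 ≤ H) (hle : ∀ i j, hbar i j ≤ 1 + H) (t : ℕ) (i : Fin M) :
    G.weight ds dr hbar t i ≤ ds ^ (-(1 / 2) : ℝ) * (1 + H) * ds
      + (ds * dr) ^ (-(1 / 2) : ℝ) * (1 + H) * (1 + H) * ds * (dr + q) := by
  have hs := hG.ds_pos
  have hr := hG.dr_pos
  have hp1 : 0 ≤ ds ^ (-(1 / 2) : ℝ) := Real.rpow_nonneg hs.le _
  have hp2 : 0 ≤ (ds * dr) ^ (-(1 / 2) : ℝ) := Real.rpow_nonneg (mul_pos hs hr).le _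
  have hnr := hG.card_relayNbr_le hq t (Sum.inl i)
  rw [weight, sum_nbr]
  refine add_le_add ?_ ?_
  · calc _ ≤ ∑ j ∈ G.sensorNbr t (Sum.inl i), ds ^ (-(1 / 2) : ℝ) * (1 + H) :=
          Finset.sum_le_sum fun j _ => mul_le_mul_of_nonneg_left (hle _ _) hp1
      _ = ds ^ (-(1 / 2) : ℝ) * (1 + H) * (G.sensorNbr t (Sum.inl i)).card := by
          rw [Finset.sum_const, nsmul_eq_mul, mul_comm]
      _ ≤ _ := mul_le_mul_of_nonneg_left (hG.le_ds _ _) (by positivity)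
  · have hj : ∀ j, ∑ k ∈ G.sensorNbr t (Sum.inr j), hbar (Sum.inr j) (Sum.inl k)
        ≤ (1 + H) * ds := fun j => by
      calc _ ≤ ∑ k ∈ G.sensorNbr t (Sum.inr j), (1 + H) := Finset.sum_le_sum fun k _ => hle _ _
        _ = (1 + H) * (G.sensorNbr t (Sum.inr j)).card := by
          rw [Finset.sum_const, nsmul_eq_mul, mul_comm]
        _ ≤ _ := mul_le_mul_of_nonneg_left (hG.le_ds _ _) (by positivity)
    calc _ ≤ ∑ j ∈ G.relayNbr t (Sum.inl i),
            (ds * dr) ^ (-(1 / 2) : ℝ) * (1 + H) * ((1 + H) * ds) :=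
          Finset.sum_le_sum fun j _ => mul_le_mul
            (mul_le_mul_of_nonneg_left (hle _ _) hp2) (hj j)
            (Finset.sum_nonneg fun k _ => (hh _ _).le) (by positivity)
      _ = (ds * dr) ^ (-(1 / 2) : ℝ) * (1 + H) * (1 + H) * ds
            * (G.relayNbr t (Sum.inl i)).card := by
          rw [Finset.sum_const, nsmul_eq_mul]
          ring
      _ ≤ _ := mul_le_mul_of_nonneg_left hnr (by positivity)

/-! ### Moments of the received data for given sensor estimates -/

theorem Assumption3.indepFun_gain (h3 : G.Assumption3 μ hbar) (t : ℕ) (i i' : Node M K)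
    {j j' : Node M K} (hj : j ≠ j') : IndepFun (G.h t i j) (G.h t i' j') μ :=
  (h3.indep_h.indepFun (i := (t, j)) (j := (t, j')) (by simpa using hj)).comp
    (measurable_pi_apply i) (measurable_pi_apply i')

theorem Assumption3.memLp_relayReception (h3 : G.Assumption3 μ hbar) (amp : ℕ → Node M K → ℝ)
    (t : ℕ) (x : Fin M → ℝ) (j : Fin K) :
    MemLp (fun ω => G.relayReception amp t x ω j) 2 μ := by
  refine memLp_finsetSum _ fun k _ => ?_
  refine MemLp.add ?_ (h3.memLp_v _ _ _)
  exact ((h3.memLp_h t (Sum.inr j) (Sum.inl k)).const_mul _).mul_const _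

variable [IsProbabilityMeasure μ]

theorem Assumption3.integral_relayReception (h3 : G.Assumption3 μ hbar) (amp : ℕ → Node M K → ℝ)
    (t : ℕ) (x : Fin M → ℝ) (j : Fin K) :
    ∫ ω, G.relayReception amp t x ω j ∂μ
      = ∑ k ∈ G.sensorNbr t (Sum.inr j), amp t (Sum.inl k) * hbar (Sum.inr j) (Sum.inl k) * x k := by
  have hh : ∀ k, Integrable
      (fun ω => amp t (Sum.inl k) * G.h t (Sum.inr j) (Sum.inl k) ω * x k) μ := fun k =>
    (((h3.memLp_h _ _ _).integrable one_le_two).const_mul _).mul_const _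
  have hv : ∀ k, Integrable (G.v t (Sum.inr j) (Sum.inl k)) μ := fun k =>
    (h3.memLp_v _ _ _).integrable one_le_two
  have hhv : ∀ k, Integrable (fun ω => amp t (Sum.inl k) * G.h t (Sum.inr j) (Sum.inl k) ω * x k
      + G.v t (Sum.inr j) (Sum.inl k) ω) μ := fun k => (hh k).add (hv k)
  unfold relayReception
  rw [integral_finsetSum _ fun k _ => hhv k]
  refine Finset.sum_congr rfl fun k _ => ?_
  rw [integral_add (hh k) (hv k), h3.mean_v, add_zero, integral_mul_const, integral_const_mul,
    h3.mean_h]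

/-- Signal and receiver noise are independent and the noise is centred, so their second moments add
without a factor 2, which the sharp bound `H Q + V` requires. Within each part Cauchy–Schwarz gives
the factor given by the number of sensors. -/
theorem integral_relayReception_sq_le (h3 : G.Assumption3 μ hbar) (h4 : G.Assumption4 μ)
    {H V W X : ℝ} (hb : G.MomentBounds μ H V W X) {ds : ℝ} (hs : 0 < ds) (dr : ℝ) (t : ℕ)
    (x : Fin M → ℝ) (j : Fin K) :
    ∫ ω, G.relayReception (scalingRule M K ds dr) t x ω j ^ 2 ∂μ
      ≤ (G.sensorNbr t (Sum.inr j)).card *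
          (H / ds * ∑ k ∈ G.sensorNbr t (Sum.inr j), x k ^ 2)
        + (G.sensorNbr t (Sum.inr j)).card ^ 2 * V := by
  set S := G.sensorNbr t (Sum.inr j) with hS
  set c := ds ^ (-(1 / 2) : ℝ) with hc
  have hh : ∀ k ∈ S, MemLp (fun ω => c * G.h t (Sum.inr j) (Sum.inl k) ω * x k) 2 μ :=
    fun k _ => ((h3.memLp_h t (Sum.inr j) (Sum.inl k)).const_mul _).mul_const _
  have hv : ∀ k ∈ S, MemLp (G.v t (Sum.inr j) (Sum.inl k)) 2 μ := fun k _ => h3.memLp_v _ _ _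
  have hind : IndepFun (fun ω => ∑ k ∈ S, c * G.h t (Sum.inr j) (Sum.inl k) ω * x k)
      (fun ω => ∑ k ∈ S, G.v t (Sum.inr j) (Sum.inl k) ω) μ := by
    refine (h4.v_h t).symm.comp
      (φ := fun z : Node M K → Node M K → ℝ => ∑ k ∈ S, c * z (Sum.inr j) (Sum.inl k) * x k)
      (ψ := fun z : Node M K → Node M K → ℝ => ∑ k ∈ S, z (Sum.inr j) (Sum.inl k)) ?_ ?_
    · fun_prop
    · fun_prop
  have h0 : ∫ ω, ∑ k ∈ S, G.v t (Sum.inr j) (Sum.inl k) ω ∂μ = 0 := by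
    rw [integral_finsetSum _ fun k hk => (hv k hk).integrable one_le_two]
    exact Finset.sum_eq_zero fun k _ => h3.mean_v _ _ _
  have hsplit : ∀ ω, G.relayReception (scalingRule M K ds dr) t x ω j
      = ∑ k ∈ S, c * G.h t (Sum.inr j) (Sum.inl k) ω * x k
        + ∑ k ∈ S, G.v t (Sum.inr j) (Sum.inl k) ω := fun ω => by
    simp only [relayReception, Finset.sum_add_distrib, scalingRule_inl]
    rfl
  simp only [hsplit]
  rw [integral_add_sq_of_indepFun (memLp_finsetSum S hh) (memLp_finsetSum S hv) hind h0]
  refine add_le_add ((integral_sum_sq_le S hh).trans ?_) ((integral_sum_sq_le S hv).trans ?_)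
  · refine mul_le_mul_of_nonneg_left ?_ (Nat.cast_nonneg _)
    rw [Finset.mul_sum]
    refine Finset.sum_le_sum fun k _ => ?_
    have : ∀ ω, (c * G.h t (Sum.inr j) (Sum.inl k) ω * x k) ^ 2
        = (ds⁻¹ * x k ^ 2) * G.h t (Sum.inr j) (Sum.inl k) ω ^ 2 := fun ω => by
      rw [← rpow_neg_half_sq hs]
      ring
    simp only [this]
    rw [integral_const_mul]
    calc _ ≤ (ds⁻¹ * x k ^ 2) * H := mul_le_mul_of_nonneg_left (hb.h_le _ _ _) (by positivity)
      _ = _ := by ring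
  · rw [pow_two, mul_assoc]
    refine mul_le_mul_of_nonneg_left ?_ (Nat.cast_nonneg _)
    calc _ ≤ ∑ k ∈ S, V := Finset.sum_le_sum fun k _ => hb.v_le _ _ _
      _ = _ := by rw [Finset.sum_const, nsmul_eq_mul]

/-- The reception of relay `j` uses receiver noises and the fading columns of sensors, whereas the
gain belongs to the column of transmitter `j`. Columns of different transmitters are independent,
and the noises are independent of all columns. -/
theorem indepFun_relayReception (h3 : G.Assumption3 μ hbar) (h4 : G.Assumption4 μ)
    (amp : ℕ → Node M K → ℝ) (t : ℕ) (x : Fin M → ℝ) (i : Node M K) (j : Fin K) :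
    IndepFun (G.h t i (Sum.inr j)) (fun ω => G.relayReception amp t x ω j) μ := by
  classical
  let T : Finset (Node M K) := Finset.univ.erase (Sum.inr j)
  have hT : ∀ k : Fin M, Sum.inl k ∈ T := fun k => by simp [T]
  have hcol : iIndepFun (fun (k : Node M K) (ω : Ω) (i : Node M K) => G.h t i k ω) μ :=
    h3.indep_h.precomp (g := fun k : Node M K => (t, k)) (Prod.mk_right_injective t)
  have hmeas : ∀ k : Node M K, Measurable fun (ω : Ω) (i : Node M K) => G.h t i k ω :=
    fun k => measurable_pi_lambda _ fun i => G.measurable_h t i k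
  have h1 : IndepFun (fun ω (k : T) (i : Node M K) => G.h t i k ω)
      (fun ω (i : Node M K) => G.h t i (Sum.inr j) ω) μ :=
    (hcol.indepFun_finset T {Sum.inr j} (by simp [T]) hmeas).comp measurable_id
      (measurable_pi_apply (⟨Sum.inr j, by simp⟩ : ({Sum.inr j} : Finset (Node M K))))
  have h2 : IndepFun (fun ω (i k : Node M K) => G.v t i k ω)
      (fun ω => ((fun (k : T) (i : Node M K) => G.h t i k ω),
        fun i : Node M K => G.h t i (Sum.inr j) ω)) μ :=
    (h4.v_h t).comp (ψ := fun z : Node M K → Node M K → ℝ =>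
      ((fun (k : T) (i : Node M K) => z i k), fun i => z i (Sum.inr j))) measurable_id
      (by fun_prop)
  have h5 := indepFun_prodMk_of_indepFun_prodMk
    (measurable_pi_lambda _ fun i => measurable_pi_lambda _ fun k => G.measurable_v t i k)
    (measurable_pi_lambda _ fun k : T => hmeas k) (hmeas _) h2 h1
  refine h5.symm.comp (φ := fun z : Node M K → ℝ => z i)
    (ψ := fun z : (Node M K → Node M K → ℝ) × (T → Node M K → ℝ) =>
      ∑ k ∈ G.sensorNbr t (Sum.inr j), (amp t (Sum.inl k) * z.2 ⟨Sum.inl k, hT k⟩ (Sum.inr j) * x k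
        + z.1 (Sum.inr j) (Sum.inl k))) (by fun_prop) (by fun_prop)

theorem Assumption3.memLp_nodeState (h3 : G.Assumption3 μ hbar) (amp : ℕ → Node M K → ℝ)
    (t : ℕ) (x : Fin M → ℝ) (j : Node M K) : MemLp (fun ω => G.nodeState amp t x ω j) 2 μ := by
  rcases j with j | j
  · exact memLp_const (x j)
  · exact h3.memLp_relayReception amp t x j

theorem indepFun_nodeState (h3 : G.Assumption3 μ hbar) (h4 : G.Assumption4 μ)
    (amp : ℕ → Node M K → ℝ) (t : ℕ) (x : Fin M → ℝ) (i j : Node M K) :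
    IndepFun (G.h t i j) (fun ω => G.nodeState amp t x ω j) μ := by
  rcases j with j | j
  · exact indepFun_const_right _ (x j)
  · exact indepFun_relayReception h3 h4 amp t x i j

theorem memLp_gain_mul_nodeState (h3 : G.Assumption3 μ hbar) (h4 : G.Assumption4 μ)
    (amp : ℕ → Node M K → ℝ) (t : ℕ) (x : Fin M → ℝ) (i j : Node M K) :
    MemLp (fun ω => amp t j * G.h t i j ω * G.nodeState amp t x ω j) 2 μ := by
  simp only [mul_assoc]
  exact (memLp_two_mul_of_indepFun (h3.memLp_h t i j) (h3.memLp_nodeState amp t x j)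
    (indepFun_nodeState h3 h4 amp t x i j)).1.const_mul _

theorem memLp_received (h3 : G.Assumption3 μ hbar) (h4 : G.Assumption4 μ)
    (amp : ℕ → Node M K → ℝ) (t : ℕ) (x : Fin M → ℝ) (i : Node M K) :
    MemLp (fun ω => G.received amp t x ω i) 2 μ :=
  memLp_finsetSum _ fun j _ =>
    (memLp_gain_mul_nodeState h3 h4 amp t x i j).add (h3.memLp_v t i j)

/-- Each gain is independent of the state it multiplies, so the means factor along both hops. -/
theorem integral_received (h3 : G.Assumption3 μ hbar) (h4 : G.Assumption4 μ)
    {ds dr : ℝ} (hs : 0 < ds) (hr : 0 < dr) (t : ℕ) (x : Fin M → ℝ) (i : Fin M) :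
    ∫ ω, G.received (scalingRule M K ds dr) t x ω (Sum.inl i) ∂μ
      = ∑ k, G.meanGain ds dr hbar t i k * x k := by
  have hterm : ∀ j, ∫ ω, (scalingRule M K ds dr t j * G.h t (Sum.inl i) j ω
        * G.nodeState (scalingRule M K ds dr) t x ω j + G.v t (Sum.inl i) j ω) ∂μ
      = scalingRule M K ds dr t j * hbar (Sum.inl i) j
        * ∫ ω, G.nodeState (scalingRule M K ds dr) t x ω j ∂μ := fun j => by
    rw [integral_add ((memLp_gain_mul_nodeState h3 h4 _ t x _ j).integrable one_le_two)
      ((h3.memLp_v _ _ _).integrable one_le_two), h3.mean_v, add_zero]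
    simp only [mul_assoc]
    rw [integral_const_mul, (indepFun_nodeState h3 h4 _ t x _ j).integral_fun_mul_eq_mul_integral
      (G.measurable_h _ _ _).aestronglyMeasurable
      (h3.memLp_nodeState _ t x j).aestronglyMeasurable, h3.mean_h]
  have hint : ∀ j, Integrable (fun ω => scalingRule M K ds dr t j * G.h t (Sum.inl i) j ω
      * G.nodeState (scalingRule M K ds dr) t x ω j + G.v t (Sum.inl i) j ω) μ := fun j =>
    ((memLp_gain_mul_nodeState h3 h4 _ t x _ j).add (h3.memLp_v _ _ _)).integrable one_le_two
  unfold received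
  rw [integral_finsetSum _ fun j _ => hint j, sum_meanGain_mul]
  simp only [hterm]
  rw [sum_nbr]
  congr 1
  · simp [nodeState, scalingRule_inl]
  · refine Finset.sum_congr rfl fun j _ => ?_
    have : ∫ ω, G.nodeState (scalingRule M K ds dr) t x ω (Sum.inr j) ∂μ
        = ∑ k ∈ G.sensorNbr t (Sum.inr j),
          ds ^ (-(1 / 2) : ℝ) * hbar (Sum.inr j) (Sum.inl k) * x k :=
      h3.integral_relayReception _ t x j
    rw [this, Finset.mul_sum, Real.mul_rpow hs.le hr.le]
    refine Finset.sum_congr rfl fun k _ => ?_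
    rw [scalingRule_inr]
    ring

/-- Receiver noises of different links at one time may be correlated, and a relay state contains
such noise, so the cross term need not vanish and the factors 2 appear. They are harmless, since
this bound is used only with the prefactor `a(t)^2`. -/
theorem integral_received_sq_le (h3 : G.Assumption3 μ hbar) (h4 : G.Assumption4 μ)
    {H V W X : ℝ} (hb : G.MomentBounds μ H V W X) (amp : ℕ → Node M K → ℝ) (t : ℕ)
    (x : Fin M → ℝ) (i : Node M K) :
    ∫ ω, G.received amp t x ω i ^ 2 ∂μ
      ≤ (G.nbr t i).card * ∑ j ∈ G.nbr t i,
          (2 * (H * (amp t j ^ 2 * ∫ ω, G.nodeState amp t x ω j ^ 2 ∂μ)) + 2 * V) := by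
  have hm := fun j => memLp_gain_mul_nodeState h3 h4 amp t x i j
  refine (integral_sum_sq_le _ fun j _ => (hm j).add (h3.memLp_v t i j)).trans ?_
  refine mul_le_mul_of_nonneg_left (Finset.sum_le_sum fun j _ => ?_) (Nat.cast_nonneg _)
  refine (integral_add_sq_le (hm j) (h3.memLp_v t i j)).trans ?_
  refine add_le_add (mul_le_mul_of_nonneg_left ?_ zero_le_two)
    (mul_le_mul_of_nonneg_left (hb.v_le _ _ _) zero_le_two)
  have hpow : ∀ ω, (amp t j * G.h t i j ω * G.nodeState amp t x ω j) ^ 2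
      = amp t j ^ 2 * (G.h t i j ω * G.nodeState amp t x ω j) ^ 2 := fun ω => by ring
  simp only [hpow]
  rw [integral_const_mul, (memLp_two_mul_of_indepFun (h3.memLp_h t i j)
    (h3.memLp_nodeState amp t x j) (indepFun_nodeState h3 h4 amp t x i j)).2]
  calc _ ≤ amp t j ^ 2 * (H * ∫ ω, G.nodeState amp t x ω j ^ 2 ∂μ) :=
        mul_le_mul_of_nonneg_left (mul_le_mul_of_nonneg_right (hb.h_le _ _ _)
          (integral_nonneg fun ω => sq_nonneg _)) (sq_nonneg _)
    _ = _ := by ring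

/-! ### The uncertainty matrix has zero mean -/

theorem integrable_and_integral_Gam {ds dr : ℝ} (hs : 0 < ds) (hr : 0 < dr)
    (h3 : G.Assumption3 μ hbar) (t : ℕ) (i j : Fin M) :
    Integrable (fun ω => G.Gam (scalingRule M K ds dr) (G.weight ds dr hbar) t ω i j) μ ∧
      ∫ ω, G.Gam (scalingRule M K ds dr) (G.weight ds dr hbar) t ω i j ∂μ = 0 := by
  by_cases hij : i = j
  swap
  · simp [Gam, Matrix.diagonal_apply_ne _ hij]
  subst hij
  simp only [Gam, Matrix.diagonal_apply_eq, scalingRule_inl, scalingRule_inr, Finset.mul_sum]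
  have h1 : ∀ k, Integrable
      (fun ω => ds ^ (-(1 / 2) : ℝ) * G.h t (Sum.inl i) (Sum.inl k) ω) μ := fun k =>
    ((h3.memLp_h _ _ _).integrable one_le_two).const_mul _
  -- The two hops have different transmitters, a relay and a sensor, so the mean of their product
  -- factors.
  have hind : ∀ l k, IndepFun (fun ω => dr ^ (-(1 / 2) : ℝ) * G.h t (Sum.inl i) (Sum.inr l) ω)
      (fun ω => ds ^ (-(1 / 2) : ℝ) * G.h t (Sum.inr l) (Sum.inl k) ω) μ := fun l k =>
    (h3.indepFun_gain t (Sum.inl i) (Sum.inr l) (j := Sum.inr l) (j' := Sum.inl k) (by simp)).comp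
      (measurable_id.const_mul _) (measurable_id.const_mul _)
  have hl : ∀ l, Integrable
      (fun ω => dr ^ (-(1 / 2) : ℝ) * G.h t (Sum.inl i) (Sum.inr l) ω) μ := fun l =>
    ((h3.memLp_h _ _ _).integrable one_le_two).const_mul _
  have hk : ∀ l k, Integrable
      (fun ω => ds ^ (-(1 / 2) : ℝ) * G.h t (Sum.inr l) (Sum.inl k) ω) μ := fun l k =>
    ((h3.memLp_h _ _ _).integrable one_le_two).const_mul _
  have h2 : ∀ l k, Integrable (fun ω => dr ^ (-(1 / 2) : ℝ) * G.h t (Sum.inl i) (Sum.inr l) ω *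
      (ds ^ (-(1 / 2) : ℝ) * G.h t (Sum.inr l) (Sum.inl k) ω)) μ := fun l k =>
    (hind l k).integrable_mul (hl l) (hk l k)
  have hS1 := integrable_finsetSum (G.sensorNbr t (Sum.inl i)) fun k _ => h1 k
  have hS2' := fun l => integrable_finsetSum (G.sensorNbr t (Sum.inr l)) fun k _ => h2 l k
  have hS2 := integrable_finsetSum (G.relayNbr t (Sum.inl i)) fun l _ => hS2' l
  refine ⟨(hS1.add hS2).sub (integrable_const _), ?_⟩
  rw [integral_sub (by exact hS1.add hS2) (integrable_const _), integral_add hS1 hS2,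
    integral_finsetSum _ fun k _ => h1 k, integral_finsetSum _ fun l _ => hS2' l,
    integral_const, probReal_univ, one_smul, weight, sum_nbr, sub_eq_zero]
  congr 1
  · refine Finset.sum_congr rfl fun k _ => ?_
    rw [integral_const_mul, h3.mean_h]
    rfl
  · refine Finset.sum_congr rfl fun l _ => ?_
    rw [integral_finsetSum _ fun k _ => h2 l k]
    simp only [weightTerm, Finset.mul_sum]
    refine Finset.sum_congr rfl fun k _ => ?_
    rw [(hind l k).integral_fun_mul_eq_mul_integral (hl l).aestronglyMeasurable
      (hk l k).aestronglyMeasurable, integral_const_mul, integral_const_mul, h3.mean_h, h3.mean_h,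
      Real.mul_rpow hs.le hr.le]
    ring

end

end RelayNetwork

end

-- Deterministic inequalities: Jensen's inequality with signed weights, and summability of the
-- squared steps.

noncomputable section

/-- Jensen's inequality for the weights `|1 - (r + a b)|`, `r` and `a c k`, where `b = ∑ c k`. -/
theorem sq_affine_combination_le {ι : Type*} (s : Finset ι) {c : ι → ℝ} (hc : ∀ k, 0 ≤ c k)
    {r a : ℝ} (hr : 0 ≤ r) (ha : 0 ≤ a) (y θ : ℝ) (x : ι → ℝ) :
    ((1 - (r + a * ∑ k ∈ s, c k)) * y + r * θ + a * ∑ k ∈ s, c k * x k) ^ 2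
      ≤ (|1 - (r + a * ∑ k ∈ s, c k)| + (r + a * ∑ k ∈ s, c k)) *
        (|1 - (r + a * ∑ k ∈ s, c k)| * y ^ 2 + r * θ ^ 2 + a * ∑ k ∈ s, c k * x k ^ 2) := by
  set b := ∑ k ∈ s, c k with hb
  set T := ∑ k ∈ s, c k * x k with hT
  set U := ∑ k ∈ s, c k * x k ^ 2 with hU
  set p := 1 - (r + a * b) with hp
  have hb0 : 0 ≤ b := Finset.sum_nonneg fun k _ => hc k
  have hTU : T ^ 2 ≤ b * U :=
    Finset.sum_sq_le_sum_mul_sum_of_sq_le_mul s (fun k _ => hc k)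
      (fun k _ => mul_nonneg (hc k) (sq_nonneg _)) fun k _ => (by ring : _ = _).le
  -- Expanding `∑ c k (x k - z)^2 ≥ 0`; used for the cross terms, with `z = e y` and `z = θ`.
  have hz : ∀ z : ℝ, 2 * z * T ≤ U + b * z ^ 2 := fun z => by
    have h : 0 ≤ ∑ k ∈ s, c k * (x k - z) ^ 2 :=
      Finset.sum_nonneg fun k _ => mul_nonneg (hc k) (sq_nonneg _)
    have h' : ∑ k ∈ s, c k * (x k - z) ^ 2 = U - 2 * z * T + b * z ^ 2 := by
      rw [hU, hT, hb, Finset.mul_sum, Finset.sum_mul, ← Finset.sum_sub_distrib,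
        ← Finset.sum_add_distrib]
      exact Finset.sum_congr rfl fun k _ => by ring
    linarith
  -- The sign of `p` is moved onto `y`, so that all weights become nonnegative while `y ^ 2` is
  -- unchanged.
  obtain ⟨e, he, hpe⟩ : ∃ e : ℝ, e ^ 2 = 1 ∧ p = |p| * e := by
    rcases le_total 0 p with h | h
    · exact ⟨1, by norm_num, by rw [abs_of_nonneg h, mul_one]⟩
    · exact ⟨-1, by norm_num, by rw [abs_of_nonpos h]; ring⟩
  have hP : 0 ≤ |p| := abs_nonneg p
  have h1 := mul_le_mul_of_nonneg_left (hz (e * y)) (mul_nonneg hP ha)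
  have h2 := mul_le_mul_of_nonneg_left (hz θ) (mul_nonneg hr ha)
  have h3 := mul_le_mul_of_nonneg_left hTU (sq_nonneg a)
  have h4 := mul_nonneg (mul_nonneg hP hr) (sq_nonneg (e * y - θ))
  rw [hpe]
  generalize |p| = P at *
  have hab : |P * e| = P := by
    have : |e| = 1 := by
      rw [← one_pow 2, sq_eq_sq_iff_abs_eq_abs, abs_one] at he
      exact he
    rw [abs_mul, this, mul_one, abs_of_nonneg hP]
  rw [hab]
  have hey : (e * y) ^ 2 = y ^ 2 := by rw [mul_pow, he, one_mul]
  have h4' : 0 ≤ P * r * (y ^ 2 - 2 * (e * y) * θ + θ ^ 2) := by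
    rw [← hey]
    linarith
  rw [hey] at h1
  have hexp : (P * e * y + r * θ + a * T) ^ 2 = P ^ 2 * y ^ 2 + r ^ 2 * θ ^ 2 + a ^ 2 * T ^ 2
      + P * a * (2 * (e * y) * T) + r * a * (2 * θ * T) + P * r * (2 * (e * y) * θ) := by
    rw [← hey]
    ring
  rw [hexp]
  linarith

/-- The left side is 1 for `s ≤ 1` and `(2 s - 1)^2` beyond; a quadratic excess is what summable
squared steps can absorb. -/
theorem sq_abs_one_sub_add_le (s : ℝ) : (|1 - s| + s) ^ 2 ≤ 1 + 4 * s ^ 2 := by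
  rcases le_total s 1 with h | h
  · rw [abs_of_nonneg (by linarith)]
    nlinarith
  · rw [abs_of_nonpos (by linarith)]
    nlinarith

theorem powerWeight_nonneg {a₀ α : ℝ} (h : 0 ≤ a₀) (t : ℕ) : 0 ≤ powerWeight a₀ α t := by
  unfold powerWeight
  split_ifs
  · exact h
  · positivity

theorem summable_powerWeight_sq (a₀ : ℝ) {α : ℝ} (h : 1 / 2 < α) :
    Summable fun t => powerWeight a₀ α t ^ 2 := by
  have hs : Summable fun t : ℕ => (t : ℝ) ^ (-α * 2) :=
    Real.summable_nat_rpow.2 (by linarith)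
  -- Index 0, which carries the arbitrary value `a₀`, is the only one where the two sequences may
  -- differ.
  rw [← summable_nat_add_iff 1] at hs ⊢
  refine hs.congr fun t => ?_
  rw [powerWeight, if_neg (Nat.succ_ne_zero t), Real.rpow_mul (Nat.cast_nonneg _)]
  norm_cast

theorem prod_one_add_mul_le_exp {f : ℕ → ℝ} (hf : ∀ t, 0 ≤ f t) (hs : Summable f) {c : ℝ}
    (hc : 0 ≤ c) (t : ℕ) :
    ∏ n ∈ Finset.range t, (1 + c * f n) ≤ Real.exp (c * ∑' n, f n) := by
  calc ∏ n ∈ Finset.range t, (1 + c * f n)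
      ≤ ∏ n ∈ Finset.range t, Real.exp (c * f n) :=
        Finset.prod_le_prod (fun n _ => by have := mul_nonneg hc (hf n); linarith) fun n _ => by
          rw [add_comm]; exact Real.add_one_le_exp _
    _ = Real.exp (c * ∑ n ∈ Finset.range t, f n) := by rw [← Real.exp_sum, Finset.mul_sum]
    _ ≤ _ := Real.exp_le_exp.2
        (mul_le_mul_of_nonneg_left (hs.sum_le_tsum _ fun n _ => hf n) hc)

namespace RelayNetwork

section

variable {M K : ℕ} {Ω : Type u} [MeasurableSpace Ω] (G : RelayNetwork M K Ω)

/-! ### Second moments of the node states -/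

/-- A bound on the second moment of the estimate of a node at time `t` in terms of the second
moments `s` of the sensor estimates. -/
def stateMoment (ds H V : ℝ) (t : ℕ) (s : Fin M → ℝ) : Node M K → ℝ
  | Sum.inl k => s k
  | Sum.inr j => (G.sensorNbr t (Sum.inr j)).card *
        (H / ds * ∑ k ∈ G.sensorNbr t (Sum.inr j), s k)
      + (G.sensorNbr t (Sum.inr j)).card ^ 2 * V

theorem measurable_stateMoment (ds H V : ℝ) (t : ℕ) (i : Node M K) :
    Measurable fun s => G.stateMoment ds H V t s i := by
  rcases i with i | i <;> simp only [stateMoment] <;> fun_prop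

/-- The bound is affine in `s`, so it commutes with expectation: estimates for frozen `x` become
estimates in terms of second moments. -/
theorem integrable_and_integral_stateMoment {μ : Measure Ω} [IsProbabilityMeasure μ]
    {Y : Ω → Fin M → ℝ} (hY : ∀ k, Integrable (fun ω => Y ω k) μ) (ds H V : ℝ) (t : ℕ)
    (i : Node M K) :
    Integrable (fun ω => G.stateMoment ds H V t (Y ω) i) μ ∧
      ∫ ω, G.stateMoment ds H V t (Y ω) i ∂μ
        = G.stateMoment ds H V t (fun k => ∫ ω, Y ω k ∂μ) i := by
  rcases i with i | i
  · exact ⟨hY i, rfl⟩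
  · simp only [stateMoment]
    have h := ((integrable_finsetSum (G.sensorNbr t (Sum.inr i))
      fun k _ => hY k).const_mul (H / ds)).const_mul ((G.sensorNbr t (Sum.inr i)).card : ℝ)
    refine ⟨h.add (integrable_const _), ?_⟩
    rw [integral_add h (integrable_const _), integral_const_mul, integral_const_mul,
      integral_finsetSum _ fun k _ => hY k, integral_const, probReal_univ, one_smul]

variable {G}

-- Power bounds from the scaling rule.

section Bounds

variable {ds dr H V Q : ℝ} {s : Fin M → ℝ}

/-- A relay that hears a sensor forces `ds ≥ 1`, so `H / ds ≤ H`; for a relay that hears none both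
sides vanish. -/
theorem stateMoment_inr_le (hG : G.ScalingConstants ds dr) (hH : 0 ≤ H) (hQ : 0 ≤ Q)
    (t : ℕ) (hs : ∀ k, s k ≤ Q) (j : Fin K) :
    G.stateMoment ds H V t s (Sum.inr j)
      ≤ ((G.sensorNbr t (Sum.inr j)).card : ℝ) ^ 2 * (H * Q + V) := by
  have hds := hG.ds_pos
  simp only [stateMoment]
  rcases (G.sensorNbr t (Sum.inr j)).eq_empty_or_nonempty with h | h
  · simp [h]
  · have h1 : (1 : ℝ) ≤ (G.sensorNbr t (Sum.inr j)).card := by exact_mod_cast Finset.card_pos.2 h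
    have hds1 : 1 ≤ ds := h1.trans (hG.le_ds t _)
    have h2 : ∑ k ∈ G.sensorNbr t (Sum.inr j), s k ≤ (G.sensorNbr t (Sum.inr j)).card * Q := by
      calc _ ≤ ∑ k ∈ G.sensorNbr t (Sum.inr j), Q := Finset.sum_le_sum fun k _ => hs k
        _ = _ := by rw [Finset.sum_const, nsmul_eq_mul]
    have h3 : H / ds ≤ H := div_le_self hH hds1
    have h4 : H / ds * ∑ k ∈ G.sensorNbr t (Sum.inr j), s k
        ≤ H * ((G.sensorNbr t (Sum.inr j)).card * Q) :=
      (mul_le_mul_of_nonneg_left h2 (div_nonneg hH hds.le)).trans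
        (mul_le_mul_of_nonneg_right h3 (by positivity))
    have := mul_le_mul_of_nonneg_left h4 (Nat.cast_nonneg (G.sensorNbr t (Sum.inr j)).card)
    nlinarith

/-- Here `dr` does its work: the relay count times the squared sensor count is at most `dr`, which
cancels the squared amplification `1 / dr`. -/
theorem card_relayNbr_mul_stateMoment_le (hG : G.ScalingConstants ds dr) (hH : 0 ≤ H)
    (hV : 0 ≤ V) (hQ : 0 ≤ Q) (t : ℕ) (hs : ∀ k, s k ≤ Q) (i : Fin M) (j : Fin K) :
    (G.relayNbr t (Sum.inl i)).card *
        (scalingRule M K ds dr t (Sum.inr j) ^ 2 * G.stateMoment ds H V t s (Sum.inr j))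
      ≤ H * Q + V := by
  have hdr := hG.dr_pos
  rw [scalingRule_inr, rpow_neg_half_sq hdr]
  have h1 := mul_le_mul_of_nonneg_left (stateMoment_inr_le (V := V) hG hH hQ t hs j)
    (Nat.cast_nonneg (G.relayNbr t (Sum.inl i)).card)
  have h2 := mul_le_mul_of_nonneg_right (hG.le_dr t i j) (by positivity : 0 ≤ H * Q + V)
  rw [mul_left_comm, ← div_eq_inv_mul, div_le_iff₀ hdr]
  linarith

/-- When no sensor listens to a relay, the requirement on `dr` says nothing; this cruder bound,
through `ds`, covers those times as well. -/
theorem relay_power_le (hG : G.ScalingConstants ds dr) (hH : 0 ≤ H) (hV : 0 ≤ V) (hQ : 0 ≤ Q)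
    (t : ℕ) (hs : ∀ k, s k ≤ Q) (j : Fin K) :
    scalingRule M K ds dr t (Sum.inr j) ^ 2 * G.stateMoment ds H V t s (Sum.inr j)
      ≤ ds ^ 2 / dr * (H * Q + V) := by
  have hdr := hG.dr_pos
  rw [scalingRule_inr, rpow_neg_half_sq hdr, div_eq_inv_mul, mul_assoc]
  refine mul_le_mul_of_nonneg_left ((stateMoment_inr_le hG hH hQ t hs j).trans ?_)
    (by positivity)
  exact mul_le_mul_of_nonneg_right
    (pow_le_pow_left₀ (Nat.cast_nonneg _) (hG.le_ds t _) 2) (by positivity)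

/-- At most `ds` sensors contribute `Q / ds` each, and each of the `n` relays heard by a sensor
contributes at most `(H Q + V) / n`. Relays hear no relays. -/
theorem sum_nbr_power_le (hG : G.ScalingConstants ds dr) (hH : 0 ≤ H) (hV : 0 ≤ V) (hQ : 0 ≤ Q)
    (t : ℕ) (hs : ∀ k, s k ≤ Q) (i : Node M K) :
    ∑ j ∈ G.nbr t i, scalingRule M K ds dr t j ^ 2 * G.stateMoment ds H V t s j
      ≤ Q + (H * Q + V) := by
  have hds := hG.ds_pos
  rw [sum_nbr]
  refine add_le_add ?_ ?_
  · simp only [scalingRule_inl, rpow_neg_half_sq hds, stateMoment]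
    calc ∑ k ∈ G.sensorNbr t i, ds⁻¹ * s k ≤ ∑ k ∈ G.sensorNbr t i, ds⁻¹ * Q :=
          Finset.sum_le_sum fun k _ => mul_le_mul_of_nonneg_left (hs k) (by positivity)
      _ = (G.sensorNbr t i).card / ds * Q := by
          rw [Finset.sum_const, nsmul_eq_mul]
          ring
      _ ≤ 1 * Q := mul_le_mul_of_nonneg_right ((div_le_one hds).2 (hG.le_ds t i)) hQ
      _ = Q := one_mul Q
  · have hpos : 0 ≤ H * Q + V := by positivity
    rcases i with i | i
    · rcases (G.relayNbr t (Sum.inl i)).eq_empty_or_nonempty with h | h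
      · rw [h, Finset.sum_empty]
        exact hpos
      · have hc : (0 : ℝ) < (G.relayNbr t (Sum.inl i)).card := by
          exact_mod_cast Finset.card_pos.2 h
        calc _ ≤ ∑ j ∈ G.relayNbr t (Sum.inl i), (H * Q + V) / (G.relayNbr t (Sum.inl i)).card :=
              Finset.sum_le_sum fun j _ => by
                rw [le_div_iff₀ hc, mul_comm]
                exact card_relayNbr_mul_stateMoment_le hG hH hV hQ t hs i j
          _ = H * Q + V := by
              rw [Finset.sum_const, nsmul_eq_mul, mul_div_cancel₀ _ hc.ne']
    · rw [relayNbr_inr, Finset.sum_empty]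
      exact hpos

end Bounds

-- The recursion for the second moments.

section Recursion

variable {μ : Measure Ω} [IsProbabilityMeasure μ] {hbar : Node M K → Node M K → ℝ}
  {H V W X ds dr : ℝ}

theorem integral_nodeState_sq_le (h3 : G.Assumption3 μ hbar) (h4 : G.Assumption4 μ)
    (hb : G.MomentBounds μ H V W X) (hs : 0 < ds) (t : ℕ) (x : Fin M → ℝ) (i : Node M K) :
    ∫ ω, G.nodeState (scalingRule M K ds dr) t x ω i ^ 2 ∂μ
      ≤ G.stateMoment ds H V t (fun k => x k ^ 2) i := by
  rcases i with i | i
  · simp [nodeState, stateMoment]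
  · exact integral_relayReception_sq_le h3 h4 hb hs dr t x i

theorem memLp_estimate_and_integral_sq_le (h3 : G.Assumption3 μ hbar) (h4 : G.Assumption4 μ)
    (h0 : G.AdmissibleInit μ) (hb : G.MomentBounds μ H V W X) (hs : 0 < ds) (θ : ℝ) (a : ℕ → ℝ)
    (b : ℕ → Fin M → ℝ) (t : ℕ)
    (hL : ∀ k, MemLp (fun ω => G.sensorEstimate θ a (scalingRule M K ds dr) b t ω k) 2 μ)
    (i : Node M K) :
    MemLp (G.estimate θ a (scalingRule M K ds dr) b t i) 2 μ ∧
      ∫ ω, G.estimate θ a (scalingRule M K ds dr) b t i ω ^ 2 ∂μ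
        ≤ G.stateMoment ds H V t
          (fun k => ∫ ω, G.sensorEstimate θ a (scalingRule M K ds dr) b t ω k ^ 2 ∂μ) i := by
  have hX := G.measurable_sensorEstimate θ a (scalingRule M K ds dr) b t
  have hmom := G.integrable_and_integral_stateMoment
    (Y := fun ω k => G.sensorEstimate θ a (scalingRule M K ds dr) b t ω k ^ 2)
    (fun k => (hL k).integrable_sq) ds H V t i
  have hcoord : ∀ x ω, G.nodeState (scalingRule M K ds dr) t x ω i
      = G.coordinateNetwork.nodeState (scalingRule M K ds dr) t x (G.disturbance t ω) i := by
    intro x ω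
    rcases i with i | i <;> rfl
  have key := memLp_two_and_integral_sq_le_of_indepFun hX (G.measurable_disturbance t)
    (G.indepFun_sensorEstimate_disturbance h4 h0 θ a (scalingRule M K ds dr) b t)
    (Φ := fun z => G.coordinateNetwork.nodeState (scalingRule M K ds dr) t z.1 z.2 i)
    (G.coordinateNetwork.measurable_nodeState _ t measurable_fst measurable_snd i)
    (g := fun x => G.stateMoment ds H V t (fun k => x k ^ 2) i)
    ((G.measurable_stateMoment ds H V t i).comp (by fun_prop)) hmom.1
    (fun x => by
      simp only [← hcoord]
      exact h3.memLp_nodeState _ t x i)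
    (fun x => by
      simp only [← hcoord]
      exact integral_nodeState_sq_le h3 h4 hb hs t x i)
  rw [hmom.2] at key
  simp only [← hcoord] at key
  exact key

/-- A bound on the second moment of the estimate of sensor `i` at time `t + 1` in terms of the
second moments `s` of the sensor estimates at time `t`; here `a` is the weight `a(t)` and `r` is
`a(t)` if the sensor has a measurement and `0` otherwise. -/
def nextMoment (G : RelayNetwork M K Ω) (ds dr H V W θ : ℝ) (hbar : Node M K → Node M K → ℝ)
    (t : ℕ) (a r : ℝ) (i : Fin M) (s : Fin M → ℝ) : ℝ :=
  (|1 - (r + a * ∑ k, G.meanGain ds dr hbar t i k)|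
      + (r + a * ∑ k, G.meanGain ds dr hbar t i k)) *
    (|1 - (r + a * ∑ k, G.meanGain ds dr hbar t i k)| * s i + r * θ ^ 2
      + a * ∑ k, G.meanGain ds dr hbar t i k * s k)
  + a ^ 2 * (2 * W + 2 * ((G.nbr t (Sum.inl i)).card * ∑ j ∈ G.nbr t (Sum.inl i),
      (2 * (H * (scalingRule M K ds dr t j ^ 2 * G.stateMoment ds H V t s j)) + 2 * V)))

theorem measurable_nextMoment (G : RelayNetwork M K Ω) (ds dr H V W θ : ℝ)
    (hbar : Node M K → Node M K → ℝ) (t : ℕ) (a r : ℝ) (i : Fin M) :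
    Measurable (G.nextMoment ds dr H V W θ hbar t a r i) := by
  have := fun j => G.measurable_stateMoment ds H V t j
  unfold nextMoment
  fun_prop

theorem integrable_and_integral_nextMoment {Y : Ω → Fin M → ℝ}
    (hY : ∀ k, Integrable (fun ω => Y ω k) μ) (ds dr H V W θ : ℝ)
    (hbar : Node M K → Node M K → ℝ) (t : ℕ) (a r : ℝ) (i : Fin M) :
    Integrable (fun ω => G.nextMoment ds dr H V W θ hbar t a r i (Y ω)) μ ∧
      ∫ ω, G.nextMoment ds dr H V W θ hbar t a r i (Y ω) ∂μ
        = G.nextMoment ds dr H V W θ hbar t a r i fun k => ∫ ω, Y ω k ∂μ := by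
  have hst := fun j => G.integrable_and_integral_stateMoment hY ds H V t j
  have hj : ∀ j, Integrable (fun ω =>
      2 * (H * (scalingRule M K ds dr t j ^ 2 * G.stateMoment ds H V t (Y ω) j)) + 2 * V) μ :=
    fun j => ((((hst j).1.const_mul _).const_mul _).const_mul _).add (integrable_const _)
  have hsum := integrable_finsetSum (G.nbr t (Sum.inl i)) fun j _ => hj j
  have h2 : Integrable (fun ω => a ^ 2 * (2 * W + 2 * ((G.nbr t (Sum.inl i)).card *
      ∑ j ∈ G.nbr t (Sum.inl i),
      (2 * (H * (scalingRule M K ds dr t j ^ 2 * G.stateMoment ds H V t (Y ω) j)) + 2 * V)))) μ :=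
    ((integrable_const _).add ((hsum.const_mul _).const_mul _)).const_mul _
  have hgain : ∀ k, Integrable (fun ω => G.meanGain ds dr hbar t i k * Y ω k) μ :=
    fun k => (hY k).const_mul _
  have hgsum := integrable_finsetSum Finset.univ fun k _ => hgain k
  have h1a : Integrable (fun ω => |1 - (r + a * ∑ k, G.meanGain ds dr hbar t i k)| * Y ω i
      + r * θ ^ 2) μ := ((hY i).const_mul _).add (integrable_const _)
  have h1 : Integrable (fun ω => |1 - (r + a * ∑ k, G.meanGain ds dr hbar t i k)| * Y ω i
      + r * θ ^ 2 + a * ∑ k, G.meanGain ds dr hbar t i k * Y ω k) μ :=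
    h1a.add (hgsum.const_mul _)
  unfold nextMoment
  refine ⟨(h1.const_mul _).add h2, ?_⟩
  rw [integral_add (h1.const_mul _) h2]
  congr 1
  · rw [integral_const_mul, integral_add h1a (hgsum.const_mul _),
      integral_add ((hY i).const_mul _) (integrable_const _), integral_const_mul,
      integral_const_mul, integral_const_mul, integral_finsetSum _ fun k _ => hgain k]
    simp [integral_const_mul]
  · rw [integral_const_mul, integral_add (integrable_const _) ((hsum.const_mul _).const_mul _),
      integral_const_mul, integral_const_mul, integral_const_mul,
      integral_finsetSum _ fun j _ => hj j]
    simp only [integral_const, probReal_univ, one_smul]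
    congr 4
    refine Finset.sum_congr rfl fun j _ => ?_
    rw [integral_add ((((hst j).1.const_mul _).const_mul _).const_mul _) (integrable_const _),
      integral_const_mul, integral_const_mul, integral_const_mul, (hst j).2]
    simp

/-- For frozen `x` the new estimate is a constant plus `a(t)` times noise and reception. Its squared
mean is handled by Jensen's inequality, and the remainder is of order `a(t)^2`. -/
theorem memLp_nextEstimate_and_integral_sq_le (hG : G.ScalingConstants ds dr)
    (h2 : G.Assumption2 μ) (h3 : G.Assumption3 μ hbar) (h4 : G.Assumption4 μ)
    (hb : G.MomentBounds μ H V W X) (hH : 0 ≤ H) (hW : 0 ≤ W) (θ : ℝ) {a : ℕ → ℝ}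
    (ha : ∀ t, 0 ≤ a t) (t : ℕ) (i : Fin M) (x : Fin M → ℝ) :
    MemLp (fun ω => G.nextEstimate θ a (scalingRule M K ds dr) (G.weight ds dr hbar) t i x ω) 2 μ ∧
      ∫ ω, G.nextEstimate θ a (scalingRule M K ds dr) (G.weight ds dr hbar) t i x ω ^ 2 ∂μ
        ≤ G.nextMoment ds dr H V W θ hbar t (a t) (if i ∈ G.measuring t then a t else 0) i
          (fun k => x k ^ 2) := by
  set r : ℝ := if i ∈ G.measuring t then a t else 0 with hr
  have hr0 : 0 ≤ r := by
    rw [hr]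
    split_ifs
    exacts [ha t, le_rfl]
  set N : Ω → ℝ := fun ω => if i ∈ G.measuring t then G.w t i ω else 0 with hN
  have hNL : MemLp N 2 μ := by
    by_cases h : i ∈ G.measuring t
    · simpa only [hN, h, if_true] using h2.memLp t i
    · simp only [hN, h, if_false]
      exact memLp_const 0
  have hN0 : ∫ ω, N ω ∂μ = 0 := by
    by_cases h : i ∈ G.measuring t
    · simpa only [hN, h, if_true] using h2.mean t i
    · simp [hN, h]
  have hN2 : ∫ ω, N ω ^ 2 ∂μ ≤ W := by
    by_cases h : i ∈ G.measuring t
    · simpa only [hN, h, if_true] using hb.w_le t i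
    · simpa [hN, h] using hW
  set u : Ω → ℝ := fun ω => G.received (scalingRule M K ds dr) t x ω (Sum.inl i) with hu
  have huL : MemLp u 2 μ := memLp_received h3 h4 _ t x _
  have hNuL : MemLp (fun ω => N ω + u ω) 2 μ := hNL.add huL
  have heq : ∀ ω, G.nextEstimate θ a (scalingRule M K ds dr) (G.weight ds dr hbar) t i x ω
      = ((1 - (r + a t * ∑ k, G.meanGain ds dr hbar t i k)) * x i + r * θ)
        + a t * (N ω + u ω) := fun ω => by
    -- Replacing the sum of the gains by the actual weight matches the coefficient of `x i` with the
    -- algorithm.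
    rw [sum_meanGain]
    simp only [nextEstimate, hr, hN, hu]
    split_ifs <;> ring
  have hadd : ∀ c, MemLp (fun ω => c + a t * (N ω + u ω)) 2 μ := fun c =>
    (memLp_const c).add (hNuL.const_mul (a t))
  simp only [heq]
  refine ⟨hadd _, ?_⟩
  refine (integral_const_add_mul_sq_le hNuL _ _).trans (add_le_add ?_ ?_)
  · have hmean : ∫ ω, (N ω + u ω) ∂μ = ∑ k, G.meanGain ds dr hbar t i k * x k := by
      rw [integral_add (hNL.integrable one_le_two) (huL.integrable one_le_two), hN0, zero_add]
      exact integral_received h3 h4 hG.ds_pos hG.dr_pos t x i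
    rw [hmean]
    exact sq_affine_combination_le _
      (fun k => G.meanGain_nonneg hG.ds_pos hG.dr_pos h3.hbar_pos t i k) hr0 (ha t) _ _ _
  · refine mul_le_mul_of_nonneg_left ((integral_add_sq_le hNL huL).trans (add_le_add
      (mul_le_mul_of_nonneg_left hN2 zero_le_two)
      (mul_le_mul_of_nonneg_left ?_ zero_le_two))) (sq_nonneg _)
    refine (integral_received_sq_le h3 h4 hb _ t x _).trans
      (mul_le_mul_of_nonneg_left (Finset.sum_le_sum fun j _ => ?_) (Nat.cast_nonneg _))
    have hj := integral_nodeState_sq_le (dr := dr) h3 h4 hb hG.ds_pos t x j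
    gcongr

theorem memLp_sensorEstimate_succ_and_integral_sq_le (hG : G.ScalingConstants ds dr)
    (h2 : G.Assumption2 μ) (h3 : G.Assumption3 μ hbar) (h4 : G.Assumption4 μ)
    (h0 : G.AdmissibleInit μ) (hb : G.MomentBounds μ H V W X) (hH : 0 ≤ H) (hW : 0 ≤ W) (θ : ℝ)
    {a : ℕ → ℝ} (ha : ∀ t, 0 ≤ a t) (t : ℕ)
    (hL : ∀ k, MemLp (fun ω => G.sensorEstimate θ a (scalingRule M K ds dr)
      (G.weight ds dr hbar) t ω k) 2 μ) (i : Fin M) :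
    MemLp (fun ω => G.sensorEstimate θ a (scalingRule M K ds dr)
        (G.weight ds dr hbar) (t + 1) ω i) 2 μ ∧
      ∫ ω, G.sensorEstimate θ a (scalingRule M K ds dr) (G.weight ds dr hbar) (t + 1) ω i ^ 2 ∂μ
        ≤ G.nextMoment ds dr H V W θ hbar t (a t) (if i ∈ G.measuring t then a t else 0) i
          (fun k => ∫ ω, G.sensorEstimate θ a (scalingRule M K ds dr)
            (G.weight ds dr hbar) t ω k ^ 2 ∂μ) := by
  have hmom := integrable_and_integral_nextMoment (G := G) (μ := μ)
    (Y := fun ω k => G.sensorEstimate θ a (scalingRule M K ds dr) (G.weight ds dr hbar) t ω k ^ 2)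
    (fun k => (hL k).integrable_sq) ds dr H V W θ hbar t (a t)
    (if i ∈ G.measuring t then a t else 0) i
  have hnext := memLp_nextEstimate_and_integral_sq_le hG h2 h3 h4 hb hH hW θ ha t i
  have key := memLp_two_and_integral_sq_le_of_indepFun
    (G.measurable_sensorEstimate θ a (scalingRule M K ds dr) (G.weight ds dr hbar) t)
    (G.measurable_disturbance t)
    (G.indepFun_sensorEstimate_disturbance h4 h0 θ a (scalingRule M K ds dr)
      (G.weight ds dr hbar) t)
    (Φ := fun z => G.coordinateNetwork.nextEstimate θ a (scalingRule M K ds dr)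
      (G.weight ds dr hbar) t i z.1 z.2)
    (G.coordinateNetwork.measurable_nextEstimate θ a _ _ t measurable_fst measurable_snd i)
    ((G.measurable_nextMoment ds dr H V W θ hbar t (a t)
      (if i ∈ G.measuring t then a t else 0) i).comp
      (by fun_prop : Measurable fun (x : Fin M → ℝ) k => x k ^ 2)) hmom.1
    (fun x => by
      simp only [← nextEstimate_eq_coordinate]
      exact (hnext x).1)
    (fun x => by
      simp only [← nextEstimate_eq_coordinate]
      exact (hnext x).2)
  simp only [← nextEstimate_eq_coordinate] at key
  exact ⟨key.1, key.2.trans_eq hmom.2⟩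

/-- Requiring `1 ≤ Z` and `θ ^ 2 ≤ Z` lets every additive constant be absorbed into a multiple of
`Z`, so the recursion becomes purely multiplicative. Since `r ≤ a`, the total weight is at most `a
(1 + β)`, which gives the term `4 (1 + β)^2`. -/
theorem nextMoment_le {q : ℕ} {a r θ β Z : ℝ} {s : Fin M → ℝ} (hG : G.ScalingConstants ds dr)
    (hq : G.IdleRelayBound q) (hh : ∀ i j, 0 < hbar i j) (hH : 0 ≤ H) (hV : 0 ≤ V) (hW : 0 ≤ W)
    (t : ℕ) (i : Fin M) (hβ : G.weight ds dr hbar t i ≤ β) (hr : 0 ≤ r) (hra : r ≤ a)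
    (hZ : 1 ≤ Z) (hθ : θ ^ 2 ≤ Z) (hs : ∀ k, s k ≤ Z) :
    G.nextMoment ds dr H V W θ hbar t a r i s
      ≤ (1 + (4 * (1 + β) ^ 2 + (2 * W + 2 * ((ds + dr + q) *
          (2 * H * (1 + H + V) + 2 * V * (ds + dr + q))))) * a ^ 2) * Z := by
  have ha : 0 ≤ a := hr.trans hra
  have hZ0 : 0 ≤ Z := zero_le_one.trans hZ
  have hgain := fun k => G.meanGain_nonneg hG.ds_pos hG.dr_pos hh t i k
  have hn := hG.card_nbr_le hq t (Sum.inl i)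
  have hpow := sum_nbr_power_le hG hH hV hZ0 t hs (Sum.inl i)
  rw [← sum_meanGain] at hβ
  unfold nextMoment
  set b := ∑ k, G.meanGain ds dr hbar t i k with hb
  set n : ℝ := ds + dr + q
  have hb0 : 0 ≤ b := Finset.sum_nonneg fun k _ => hgain k
  have hS0 : 0 ≤ r + a * b := by positivity
  have hS : r + a * b ≤ a * (1 + β) := by
    have := mul_le_mul_of_nonneg_left hβ ha
    linarith
  have hU : ∑ k, G.meanGain ds dr hbar t i k * s k ≤ b * Z := by
    rw [hb, Finset.sum_mul]
    exact Finset.sum_le_sum fun k _ => mul_le_mul_of_nonneg_left (hs k) (hgain k)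
  set S := r + a * b with hSdef
  have hfirst : (|1 - S| + S) * (|1 - S| * s i + r * θ ^ 2
      + a * ∑ k, G.meanGain ds dr hbar t i k * s k) ≤ (1 + 4 * (1 + β) ^ 2 * a ^ 2) * Z := by
    have h1 : |1 - S| * s i + r * θ ^ 2 + a * ∑ k, G.meanGain ds dr hbar t i k * s k
        ≤ (|1 - S| + S) * Z := by
      have e1 := mul_le_mul_of_nonneg_left (hs i) (abs_nonneg (1 - S))
      have e2 := mul_le_mul_of_nonneg_left hθ hr
      have e3 := mul_le_mul_of_nonneg_left hU ha
      rw [hSdef] at e1 ⊢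
      linarith
    have h2 : (|1 - S| + S) ^ 2 ≤ 1 + 4 * (1 + β) ^ 2 * a ^ 2 := by
      have := pow_le_pow_left₀ hS0 hS 2
      linarith [sq_abs_one_sub_add_le S]
    calc _ ≤ (|1 - S| + S) * ((|1 - S| + S) * Z) :=
          mul_le_mul_of_nonneg_left h1 (add_nonneg (abs_nonneg _) hS0)
      _ = (|1 - S| + S) ^ 2 * Z := by ring
      _ ≤ _ := mul_le_mul_of_nonneg_right h2 hZ0
  have hn0 : 0 ≤ n := (Nat.cast_nonneg _).trans hn
  have hsum : ∑ j ∈ G.nbr t (Sum.inl i),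
      (2 * (H * (scalingRule M K ds dr t j ^ 2 * G.stateMoment ds H V t s j)) + 2 * V)
        ≤ (2 * H * (1 + H + V) + 2 * V * n) * Z := by
    rw [Finset.sum_add_distrib, ← Finset.mul_sum, ← Finset.mul_sum, Finset.sum_const, nsmul_eq_mul]
    have e1 := mul_le_mul_of_nonneg_left hpow hH
    have e2 := mul_le_mul_of_nonneg_right hn (by positivity : 0 ≤ 2 * V)
    have e3 := mul_le_mul_of_nonneg_left hZ (by positivity : 0 ≤ 2 * V * n)
    have e4 := mul_le_mul_of_nonneg_left hZ (by positivity : 0 ≤ 2 * H * V)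
    linarith
  have hcn : ((G.nbr t (Sum.inl i)).card : ℝ) * ∑ j ∈ G.nbr t (Sum.inl i),
      (2 * (H * (scalingRule M K ds dr t j ^ 2 * G.stateMoment ds H V t s j)) + 2 * V)
        ≤ n * ((2 * H * (1 + H + V) + 2 * V * n) * Z) :=
    (mul_le_mul_of_nonneg_left hsum (Nat.cast_nonneg _)).trans
      (mul_le_mul_of_nonneg_right hn (by positivity))
  have hsecond := mul_le_mul_of_nonneg_left (add_le_add
    (mul_le_mul_of_nonneg_left hZ (by positivity : 0 ≤ 2 * W))
    (mul_le_mul_of_nonneg_left hcn zero_le_two)) (sq_nonneg a)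
  rw [mul_one] at hsecond
  linarith

/-- The second moments of the sensor estimates grow at most by the factors `1 + C a(t) ^ 2`, with
`C` independent of the network. -/
theorem memLp_sensorEstimate_and_integral_sq_le {q : ℕ} (hG : G.ScalingConstants ds dr)
    (hq : G.IdleRelayBound q) (h2 : G.Assumption2 μ) (h3 : G.Assumption3 μ hbar)
    (h4 : G.Assumption4 μ) (h0 : G.AdmissibleInit μ) (hb : G.MomentBounds μ H V W X) (hH : 0 ≤ H)
    (hV : 0 ≤ V) (hW : 0 ≤ W) (hX : 0 ≤ X) (θ : ℝ) {a : ℕ → ℝ} (ha : ∀ t, 0 ≤ a t) {β C : ℝ}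
    (hβ : ∀ t i, G.weight ds dr hbar t i ≤ β) (hC0 : 0 ≤ C)
    (hC : 4 * (1 + β) ^ 2 + (2 * W + 2 * ((ds + dr + q) *
          (2 * H * (1 + H + V) + 2 * V * (ds + dr + q)))) ≤ C) (t : ℕ) (i : Fin M) :
    MemLp (fun ω => G.sensorEstimate θ a (scalingRule M K ds dr)
        (G.weight ds dr hbar) t ω i) 2 μ ∧
      ∫ ω, G.sensorEstimate θ a (scalingRule M K ds dr) (G.weight ds dr hbar) t ω i ^ 2 ∂μ
        ≤ (X + θ ^ 2 + 1) * ∏ n ∈ Finset.range t, (1 + C * a n ^ 2) := by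
  have hfac : ∀ n, 1 ≤ 1 + C * a n ^ 2 := fun n => by
    have := mul_nonneg hC0 (sq_nonneg (a n))
    linarith
  induction t generalizing i with
  | zero =>
    refine ⟨h0.memLp i, ?_⟩
    simp only [Finset.range_zero, Finset.prod_empty, mul_one]
    have := hb.x₀_le i
    have hsq := sq_nonneg θ
    refine le_trans this ?_
    linarith
  | succ t ih =>
    have hstep := memLp_sensorEstimate_succ_and_integral_sq_le hG h2 h3 h4 h0 hb hH hW θ ha t
      (fun k => (ih k).1) i
    refine ⟨hstep.1, hstep.2.trans ?_⟩
    set P := ∏ n ∈ Finset.range t, (1 + C * a n ^ 2) with hP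
    have hP1 : 1 ≤ P := Finset.one_le_prod fun n _ => hfac n
    -- The three summands cover the initial moments and the conditions `θ ^ 2 ≤ Z` and `1 ≤ Z`; as
    -- `P ≥ 1`, these conditions persist in time.
    have hZ : ∀ y, y ≤ X + θ ^ 2 + 1 → y ≤ (X + θ ^ 2 + 1) * P := fun y hy =>
      hy.trans (le_mul_of_one_le_right (by positivity) hP1)
    refine (nextMoment_le hG hq h3.hbar_pos hH hV hW t i (hβ t i) ?_ ?_
      (hZ 1 (by nlinarith [sq_nonneg θ])) (hZ _ (by linarith)) fun k => (ih k).2).trans ?_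
    · split_ifs
      exacts [ha t, le_rfl]
    · split_ifs
      exacts [le_rfl, ha t]
    · rw [Finset.prod_range_succ, ← hP]
      have hle := mul_le_mul_of_nonneg_right hC (sq_nonneg (a t))
      calc _ ≤ (1 + C * a t ^ 2) * ((X + θ ^ 2 + 1) * P) :=
            mul_le_mul_of_nonneg_right (by linarith) (by positivity)
        _ = _ := by ring

end Recursion

end

end RelayNetwork

end

-- From second moments to transmit and received powers.

noncomputable section

namespace RelayNetwork

section

variable {M K : ℕ} {Ω : Type u} [MeasurableSpace Ω] {G : RelayNetwork M K Ω} {μ : Measure Ω}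
  {hbar : Node M K → Node M K → ℝ} {H V W X ds dr : ℝ}

theorem Assumption2.nonempty_sensors (h2 : G.Assumption2 μ) : Nonempty (Fin M) := by
  obtain ⟨T, _, hT⟩ := h2.measurements
  obtain ⟨s, _, _, i, _⟩ := hT 0
  exact ⟨i⟩

/-- The final constant is chosen for moment bounds of arbitrary sign; a sensor supplies second
moments that force them to be nonnegative. -/
theorem MomentBounds.nonneg [hM : Nonempty (Fin M)] (hb : G.MomentBounds μ H V W X) :
    0 ≤ H ∧ 0 ≤ V ∧ 0 ≤ W ∧ 0 ≤ X := by
  obtain ⟨i⟩ := hM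
  exact ⟨(integral_nonneg fun ω => sq_nonneg _).trans (hb.h_le 0 (Sum.inl i) (Sum.inl i)),
    (integral_nonneg fun ω => sq_nonneg _).trans (hb.v_le 0 (Sum.inl i) (Sum.inl i)),
    (integral_nonneg fun ω => sq_nonneg _).trans (hb.w_le 0 i),
    (integral_nonneg fun ω => sq_nonneg _).trans (hb.x₀_le i)⟩

theorem transmitPower_inl_le {θ : ℝ} {a : ℕ → ℝ} {b : ℕ → Fin M → ℝ} {t : ℕ} {Q : ℝ} (hs : 0 < ds)
    {i : Fin M}
    (hQ : ∫ ω, G.sensorEstimate θ a (scalingRule M K ds dr) b t ω i ^ 2 ∂μ ≤ Q) :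
    G.transmitPower μ θ a (scalingRule M K ds dr) b t (Sum.inl i) ≤ Q / ds := by
  rw [transmitPower, scalingRule_inl, rpow_neg_half_sq hs, div_eq_inv_mul]
  exact mul_le_mul_of_nonneg_left hQ (inv_nonneg.2 hs.le)

variable [IsProbabilityMeasure μ]

theorem mean_gain_le (h3 : G.Assumption3 μ hbar) (hb : G.MomentBounds μ H V W X)
    (i j : Node M K) : hbar i j ≤ 1 + H := by
  have h := (sq_integral_le_integral_sq (h3.memLp_h 0 i j)).trans (hb.h_le 0 i j)
  rw [h3.mean_h] at h
  -- From `hbar ^ 2 ≤ H`; the form `1 + H` avoids a square root.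
  nlinarith [sq_nonneg (hbar i j - 1)]

theorem transmitPower_le_stateMoment (h3 : G.Assumption3 μ hbar) (h4 : G.Assumption4 μ)
    (h0 : G.AdmissibleInit μ) (hb : G.MomentBounds μ H V W X) (hs : 0 < ds) (θ : ℝ) (a : ℕ → ℝ)
    (b : ℕ → Fin M → ℝ) (t : ℕ)
    (hL : ∀ k, MemLp (fun ω => G.sensorEstimate θ a (scalingRule M K ds dr) b t ω k) 2 μ)
    (i : Node M K) :
    G.transmitPower μ θ a (scalingRule M K ds dr) b t i
      ≤ scalingRule M K ds dr t i ^ 2 * G.stateMoment ds H V t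
          (fun k => ∫ ω, G.sensorEstimate θ a (scalingRule M K ds dr) b t ω k ^ 2 ∂μ) i :=
  mul_le_mul_of_nonneg_left
    (memLp_estimate_and_integral_sq_le h3 h4 h0 hb hs θ a b t hL i).2 (sq_nonneg _)

theorem receivedPower_le (hG : G.ScalingConstants ds dr) (h3 : G.Assumption3 μ hbar)
    (h4 : G.Assumption4 μ) (h0 : G.AdmissibleInit μ) (hb : G.MomentBounds μ H V W X) (hH : 0 ≤ H)
    (hV : 0 ≤ V) {κ Q : ℝ} (hκ : 0 ≤ κ) (hQ0 : 0 ≤ Q) (θ : ℝ) (a : ℕ → ℝ) (b : ℕ → Fin M → ℝ)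
    (t : ℕ) (hL : ∀ k, MemLp (fun ω => G.sensorEstimate θ a (scalingRule M K ds dr) b t ω k) 2 μ)
    (hQ : ∀ k, ∫ ω, G.sensorEstimate θ a (scalingRule M K ds dr) b t ω k ^ 2 ∂μ ≤ Q)
    (i : Node M K) :
    G.receivedPower μ κ θ a (scalingRule M K ds dr) b t i ≤ κ * (Q + (H * Q + V)) :=
  mul_le_mul_of_nonneg_left ((Finset.sum_le_sum fun j _ =>
    transmitPower_le_stateMoment h3 h4 h0 hb hG.ds_pos θ a b t hL j).trans
      (sum_nbr_power_le hG hH hV hQ0 t hQ i)) hκ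

end

end RelayNetwork

end

theorem proposition5 :
    -- the uncertainty matrix has zero mean
    (∀ (M K : ℕ) (Ω : Type u) [MeasurableSpace Ω] (μ : Measure Ω) [IsProbabilityMeasure μ]
        (G : RelayNetwork M K Ω) (hbar : Node M K → Node M K → ℝ) (ds dr : ℝ),
        G.ScalingConstants ds dr → G.Assumption3 μ hbar →
        ∀ (t : ℕ) (i j : Fin M),
          Integrable (fun ω => G.Gam (scalingRule M K ds dr) (G.weight ds dr hbar) t ω i j) μ ∧
          ∫ ω, G.Gam (scalingRule M K ds dr) (G.weight ds dr hbar) t ω i j ∂μ = 0) ∧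
    -- the powers are bounded, with a bound that is chosen before the numbers of nodes
    (∀ (θ α a₀ κ ds dr H V W X : ℝ) (q : ℕ),
        1 / 2 < α → α ≤ 1 → 0 ≤ a₀ → 0 < κ → 0 < ds → 0 < dr →
        ∃ C : ℝ,
        ∀ (M K : ℕ) (Ω : Type u) [MeasurableSpace Ω] (μ : Measure Ω) [IsProbabilityMeasure μ]
          (G : RelayNetwork M K Ω) (hbar : Node M K → Node M K → ℝ),
          G.ScalingConstants ds dr →
          G.Assumption1 μ → G.Assumption2 μ → G.Assumption3 μ hbar → G.Assumption4 μ →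
          G.AdmissibleInit μ → G.MomentBounds μ H V W X → G.IdleRelayBound q →
          ∀ t : ℕ,
            (∀ i : Node M K,
              MemLp (G.estimate θ (powerWeight a₀ α) (scalingRule M K ds dr)
                (G.weight ds dr hbar) t i) 2 μ ∧
              G.transmitPower μ θ (powerWeight a₀ α) (scalingRule M K ds dr)
                (G.weight ds dr hbar) t i ≤ C ∧
              G.receivedPower μ κ θ (powerWeight a₀ α) (scalingRule M K ds dr)
                (G.weight ds dr hbar) t i ≤ C) ∧
            -- the powers are controlled by the second moments of the sensor estimates alone,
            -- uniformly in the scaling constants as well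
            (∀ Q : ℝ,
              (∀ j : Fin M, ∫ ω, G.estimate θ (powerWeight a₀ α) (scalingRule M K ds dr)
                (G.weight ds dr hbar) t (Sum.inl j) ω ^ 2 ∂μ ≤ Q) →
              (∀ i : Fin M, G.transmitPower μ θ (powerWeight a₀ α) (scalingRule M K ds dr)
                (G.weight ds dr hbar) t (Sum.inl i) ≤ Q / ds) ∧
              (∀ j : Fin K, (∃ i : Fin M, (G.relayNbr t (Sum.inl i)).Nonempty) →
                G.transmitPower μ θ (powerWeight a₀ α) (scalingRule M K ds dr)
                  (G.weight ds dr hbar) t (Sum.inr j) ≤ H * Q + V) ∧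
              (∀ i : Node M K, G.receivedPower μ κ θ (powerWeight a₀ α) (scalingRule M K ds dr)
                (G.weight ds dr hbar) t i ≤ κ * (Q + (H * Q + V))))) := by
  refine ⟨fun M K Ω _ μ _ G hbar ds dr hG h3 t i j =>
    RelayNetwork.integrable_and_integral_Gam hG.ds_pos hG.dr_pos h3 t i j, ?_⟩
  intro θ α a₀ κ ds dr H V W X q hα _ ha₀ hκ hds hdr
  let β : ℝ := ds ^ (-(1 / 2) : ℝ) * (1 + H) * ds
    + (ds * dr) ^ (-(1 / 2) : ℝ) * (1 + H) * (1 + H) * ds * (dr + q)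
  let C₀ : ℝ := 4 * (1 + β) ^ 2 + (2 * W + 2 * ((ds + dr + q) *
    (2 * H * (1 + H + V) + 2 * V * (ds + dr + q))))
  let Z : ℝ := (X + θ ^ 2 + 1) * Real.exp (C₀ * ∑' n, powerWeight a₀ α n ^ 2)
  -- The sum of the bounds for sensor, relay and received power; all three are nonnegative once a
  -- network is given, so the sum dominates each.
  refine ⟨Z / ds + ds ^ 2 / dr * (H * Z + V) + κ * (Z + (H * Z + V)), ?_⟩
  intro M K Ω _ μ _ G hbar hG _ h2 h3 h4 h0 hb hq t
  have hM := h2.nonempty_sensors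
  obtain ⟨hH, hV, hW, hX⟩ := hb.nonneg
  have hC₀ : 0 ≤ C₀ := by positivity
  have ha := powerWeight_nonneg (α := α) ha₀
  have hsens := RelayNetwork.memLp_sensorEstimate_and_integral_sq_le hG hq h2 h3 h4 h0 hb hH hV hW
    hX θ ha (β := β) (RelayNetwork.weight_le hG hq h3.hbar_pos hH
      (RelayNetwork.mean_gain_le h3 hb)) hC₀ le_rfl t
  have hL := fun i => (hsens i).1
  have hZ := fun i => (hsens i).2.trans (mul_le_mul_of_nonneg_left
    (prod_one_add_mul_le_exp (fun n => sq_nonneg (powerWeight a₀ α n))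
      (summable_powerWeight_sq a₀ hα) hC₀ t) (by positivity : 0 ≤ X + θ ^ 2 + 1))
  have hZ0 : 0 ≤ Z := by positivity
  have hA : 0 ≤ Z / ds := by positivity
  have hB : 0 ≤ ds ^ 2 / dr * (H * Z + V) := by positivity
  have hR : 0 ≤ κ * (Z + (H * Z + V)) := by positivity
  have hpow := RelayNetwork.transmitPower_le_stateMoment (dr := dr) h3 h4 h0 hb hds θ
    (powerWeight a₀ α) (G.weight ds dr hbar) t hL
  refine ⟨fun i => ⟨(RelayNetwork.memLp_estimate_and_integral_sq_le h3 h4 h0 hb hds θ _ _ t hL i).1,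
    ?_, ?_⟩, fun Q hQ => ?_⟩
  · rcases i with i | i
    · have := RelayNetwork.transmitPower_inl_le hds (hZ i)
      linarith
    · have := (hpow (Sum.inr i)).trans (RelayNetwork.relay_power_le hG hH hV hZ0 t hZ i)
      linarith
  · have := RelayNetwork.receivedPower_le hG h3 h4 h0 hb hH hV hκ.le hZ0 θ
      (powerWeight a₀ α) (G.weight ds dr hbar) t hL hZ i
    linarith
  · obtain ⟨i₀⟩ := hM
    have hQ0 : 0 ≤ Q := (integral_nonneg fun ω => sq_nonneg _).trans (hQ i₀)
    refine ⟨fun i => RelayNetwork.transmitPower_inl_le hds (hQ i), fun j => ?_,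
      RelayNetwork.receivedPower_le hG h3 h4 h0 hb hH hV hκ.le hQ0 θ _ _ t hL hQ⟩
    rintro ⟨i, hi⟩
    refine (hpow (Sum.inr j)).trans (le_trans ?_
      (RelayNetwork.card_relayNbr_mul_stateMoment_le hG hH hV hQ0 t hQ i j))
    -- Some sensor `i` listens to at least one relay, not necessarily to `j`, so the power of `j` is
    -- at most the relay count of `i` times that power.
    refine le_mul_of_one_le_left ?_ (by exact_mod_cast Finset.card_pos.2 hi)
    exact mul_nonneg (sq_nonneg _) ((integral_nonneg fun ω => sq_nonneg _).trans
      (RelayNetwork.memLp_estimate_and_integral_sq_le h3 h4 h0 hb hds θ _ _ t hL (Sum.inr j)).2)
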